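/- Fix $\beta,m,\delta_*>0$ and $\theta\in(0,1)$. For $k,k'\ge 0$, $c\in[-1,1]$ put $r=\sqrt{k^2+k'^2-2kk'c}$, $v=r/m$, $\Delta=k'-k$, and $$\mathcal B_\beta(k,k')=\sqrt\beta\,e^{\beta\frac{k+k'}2}\int_{-1}^1\frac{1+c^2}{r}\exp\Big(-\beta\,\frac{\Delta^2+\frac{m^2v^4}{4}}{2mv^2}\Big)\,dc .$$ For $\rho>0$ let $D(\theta,\rho)\subset[0,\infty)^2$ be the set of $(k,k')$ such that $|k-k'|\le\rho\sqrt{kk'(k+k')}$ if $(k,k')\in[0,\delta_*]^2$, and $\theta k\le k'\le\theta^{-1}k$ otherwise; let $D=D(\theta,\rho_*)$ with $\rho_*=\frac{1-\theta}{\sqrt{\delta_*\theta(1+\theta)}}$ (the value making the boundary curves continuous), and $\gamma_1(x)=\min\{y:(x,y)\in D\}$. Let $\Phi:[0,\infty)^2\to[0,1]$ be symmetric, continuous on $[0,\infty)^2\setminus\{(0,0)\}$, with $\operatorname{supp}\Phi=D$, and $\Phi=1$ on $D(\theta_1,\rho_1)\subset D$ for some $\theta_1\in(\theta,1)$, $\rho_1>0$.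 Set $$R(k,k')=\big(e^{-\beta k}-e^{-\beta k'}\big)\frac{\mathcal B_\beta(k,k')\Phi(k,k')}{kk'}$$ (taken to be $0$ on the axes). Let $\mathscr M_+([0,\infty))$ be the space of finite nonnegative Borel measures on $[0,\infty)$ with the narrow topology, and $X_\eta(v)=\int_{[0,\infty)}e^{\eta k}\,dv(k)$. Let $v_0\in\mathscr M_+([0,\infty))$ satisfy $X_\eta(v_0)<\infty$ for some $\eta\ge(1-\theta)/2$, and let $v\in C([0,\infty),\mathscr M_+([0,\infty)))$ be a weak solution of $$\frac{\partial v}{\partial t}(t,k)=v(t,k)\int_{[0,\infty)}R(k,k')\,v(t,k')\,dk'$$ with $v(0)=v_0$: for every $\varphi\in C^1_b([0,\infty))$ with $\varphi'(0)=0$, the function $t\mapsto\int\varphi\,dv(t)$ belongs to $W^{1,\infty}_{loc}([0,\infty))$ and, for a.e. $t>0$, $$\frac{d}{dt}\int_{[0,\infty)}\varphi\,dv(t)=\frac12\iint_{[0,\infty)^2}R(k,k')\big(\varphi(k)-\varphi(k')\big)\,dv(t)(k)\,dv(t)(k'),$$ the double integral being absolutely convergent. Assume also $v(t)([0,\infty))=v_0([0,\infty))$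 and $X_\eta(v(t))\le X_\eta(v_0)$ for all $t\ge0$. Define the blocks of $v_0$ as follows. Remove from $[0,\infty)$ every bounded connected component $I$ of $[0,\infty)\setminus\operatorname{supp}v_0$ such that $\inf I\le\gamma_1(\sup I)$. The blocks $A_n(v_0)$ are the intersections with $\operatorname{supp}v_0$ of the connected components of the remaining set. **Theorem.** There are a countable (possibly finite or empty) set $S\subset\operatorname{supp}v_0$ and masses $M'_k>0$, $k\in S$, such that the measure $\mu=\sum_{k\in S}M'_k\,\delta_k$ is finite and, as $s\to\infty$, $v(s+\cdot)$ converges in $C([0,\infty),\mathscr M_+([0,\infty)))$ (uniformly on compact time intervals) to the constant map $\mu$; in particular $v(s)\to\mu$ narrowly. Moreover: 1. $\Phi(k,k')=0$ for all $k\ne k'$ in $S$; 2. $\sum_{k\in S\cap A_n(v_0)}M'_k=v_0(A_n(v_0))$ for every block $A_n(v_0)$; 3. if a block has a minimum $k_n=\min A_n(v_0)>0$, then $k_n\in S$. -/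

import Mathlib

open MeasureTheory Set Filter Topology
open scoped NNReal ENNReal

namespace Compton

noncomputable section

/-! ### The truncated kernel -/

/-- Momentum transfer `|𝐤' - 𝐤|` of two vectors of `ℝ³` of lengths `k`, `k'`, where `c` is the
cosine of the angle between them. -/
def momentumTransfer (k k' c : ℝ) : ℝ := Real.sqrt (k ^ 2 + k' ^ 2 - 2 * k * k' * c)

/-- The redistribution function `𝓑_β(k, k')` for electrons of mass `m`; the angular integral is
written in the variable `c = cos θ ∈ [-1, 1]`, with `v = |𝐤' - 𝐤| / m` and `Δ = k' - k`. -/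
def redistribution (β m k k' : ℝ) : ℝ :=
  Real.sqrt β * Real.exp (β * (k' + k) / 2) *
    ∫ c in (-1 : ℝ)..1,
      (1 + c ^ 2) / momentumTransfer k k' c *
        Real.exp (-β * (((k' - k) ^ 2 + m ^ 2 * (momentumTransfer k k' c / m) ^ 4 / 4) /
          (2 * m * (momentumTransfer k k' c / m) ^ 2)))

/-- The region of pairs `(k, k')` with `|k - k'| ≤ ρ √(k k' (k + k'))` inside the square `[0, δ]²`
and `θ k ≤ k' ≤ θ⁻¹ k` outside it. -/
def region (θ δ ρ : ℝ) : Set (ℝ≥0 × ℝ≥0) :=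
  {p | (((p.1 : ℝ) ≤ δ ∧ (p.2 : ℝ) ≤ δ) →
          |(p.1 : ℝ) - p.2| ≤ ρ * Real.sqrt (p.1 * p.2 * (p.1 + p.2))) ∧
       (¬ ((p.1 : ℝ) ≤ δ ∧ (p.2 : ℝ) ≤ δ) →
          θ * (p.1 : ℝ) ≤ p.2 ∧ (p.2 : ℝ) ≤ θ⁻¹ * p.1)}

/-- The value of `ρ_*` for which the boundary curves of the region are continuous. -/
def rhoStar (θ δ : ℝ) : ℝ := (1 - θ) / Real.sqrt (δ * θ * (1 + θ))

/-- The interaction region `D`. -/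
def interactionRegion (θ δ : ℝ) : Set (ℝ≥0 × ℝ≥0) := region θ δ (rhoStar θ δ)

/-- `Φ` is a cut-off function with parameters `θ` and `δ`: symmetric, with values in `[0, 1]`,
continuous away from the origin, with support exactly `D`, and equal to `1` on a smaller region of
the same shape around the diagonal. -/
structure IsCutoff (θ δ : ℝ) (Φ : ℝ≥0 → ℝ≥0 → ℝ) : Prop where
  nonneg : ∀ k k', 0 ≤ Φ k k'
  le_one : ∀ k k', Φ k k' ≤ 1
  symm : ∀ k k', Φ k k' = Φ k' k
  continuousOn : ContinuousOn (fun p : ℝ≥0 × ℝ≥0 => Φ p.1 p.2) {(0, 0)}ᶜ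
  support_eq : tsupport (fun p : ℝ≥0 × ℝ≥0 => Φ p.1 p.2) = interactionRegion θ δ
  eq_one : ∃ θ₁ ρ₁ : ℝ, θ < θ₁ ∧ θ₁ < 1 ∧ 0 < ρ₁ ∧
    region θ₁ δ ρ₁ ⊆ interactionRegion θ δ ∧ ∀ p ∈ region θ₁ δ ρ₁, Φ p.1 p.2 = 1

/-- `R(k, k') = (e^{-βk} - e^{-βk'}) 𝓑_β(k, k') Φ(k, k') / (k k')`. On the axes `Φ` vanishes off the
origin, and at the origin the first factor vanishes, so the value there is `0`. -/
def rate (β m : ℝ) (Φ : ℝ≥0 → ℝ≥0 → ℝ) (k k' : ℝ≥0) : ℝ :=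
  (Real.exp (-β * k) - Real.exp (-β * k')) *
    (redistribution β m k k' * Φ k k' / ((k : ℝ) * k'))

/-! ### Weak solutions -/

/-- `φ ∈ C¹_b([0, ∞))` with `φ'(0) = 0`; only the values of `φ` on `[0, ∞)` matter. -/
structure IsTest (φ : ℝ → ℝ) : Prop where
  contDiffOn : ContDiffOn ℝ 1 φ (Ici 0)
  bounded : ∃ C, ∀ x ∈ Ici (0 : ℝ), |φ x| ≤ C
  deriv_bounded : ∃ C, ∀ x ∈ Ici (0 : ℝ), |derivWithin φ (Ici 0) x| ≤ C
  deriv_zero : derivWithin φ (Ici 0) 0 = 0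

/-- The exponential moment `X_η(v) = ∫ e^{ηk} dv(k)`. -/
def expMoment (η : ℝ) (v : FiniteMeasure ℝ≥0) : ℝ≥0∞ :=
  ∫⁻ k : ℝ≥0, ENNReal.ofReal (Real.exp (η * k)) ∂(v : Measure ℝ≥0)

/-- `v` is a weak solution of the simplified equation
`∂v/∂t (t, k) = v(t, k) ∫ R(k, k') v(t, k') dk'` with initial datum `v₀`.
`FiniteMeasure ℝ≥0` is the space of finite nonnegative measures on `[0, ∞)` with the narrow
topology, so that an element of `C(ℝ≥0, FiniteMeasure ℝ≥0)` is a map `t ↦ v(t)` for which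
`t ↦ ∫ φ dv(t)` is continuous for all bounded continuous `φ`. Local `W^{1,∞}` regularity of the
continuous function `t ↦ ∫ φ dv(t)` on `[0, ∞)` is Lipschitz continuity on each `[0, T]`. -/
structure IsWeakSolution (β m : ℝ) (Φ : ℝ≥0 → ℝ≥0 → ℝ)
    (v₀ : FiniteMeasure ℝ≥0) (v : C(ℝ≥0, FiniteMeasure ℝ≥0)) : Prop where
  initial : v 0 = v₀
  lipschitz : ∀ φ : ℝ → ℝ, IsTest φ → ∀ T : ℝ≥0, ∃ L : ℝ≥0,
    LipschitzOnWith L (fun t : ℝ≥0 => ∫ k : ℝ≥0, φ k ∂(v t : Measure ℝ≥0)) (Iic T)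
  weak : ∀ φ : ℝ → ℝ, IsTest φ → ∀ᵐ t : ℝ ∂(volume.restrict (Ioi 0)),
    Integrable (fun p : ℝ≥0 × ℝ≥0 => rate β m Φ p.1 p.2 * (φ p.1 - φ p.2))
      ((v t.toNNReal : Measure ℝ≥0).prod (v t.toNNReal : Measure ℝ≥0)) ∧
    HasDerivAt (fun s : ℝ => ∫ k : ℝ≥0, φ k ∂(v s.toNNReal : Measure ℝ≥0))
      (1 / 2 * ∫ p : ℝ≥0 × ℝ≥0, rate β m Φ p.1 p.2 * (φ p.1 - φ p.2)
        ∂((v t.toNNReal : Measure ℝ≥0).prod (v t.toNNReal : Measure ℝ≥0))) t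

/-- The weak solutions provided by the existence theory for data with `X_η(v₀) < ∞`: they
conserve the mass and do not increase the exponential moment. -/
structure IsAdmissibleSolution (β m η : ℝ) (Φ : ℝ≥0 → ℝ≥0 → ℝ)
    (v₀ : FiniteMeasure ℝ≥0) (v : C(ℝ≥0, FiniteMeasure ℝ≥0)) : Prop
    extends IsWeakSolution β m Φ v₀ v where
  mass_eq : ∀ t, (v t).mass = v₀.mass
  expMoment_le : ∀ t, expMoment η (v t) ≤ expMoment η v₀

/-! ### The blocks of a measure -/

/-- The lower boundary curve `γ₁` of `D`: the least `y` with `(x, y) ∈ D`. -/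
def lowerEdge (θ δ : ℝ) (x : ℝ≥0) : ℝ≥0 := sInf {y | (x, y) ∈ interactionRegion θ δ}

/-- The union of the bounded gaps `I` of the closed set `K ⊆ [0, ∞)` (bounded connected components
of its complement) whose endpoints `a = inf I`, `b = sup I` satisfy `a ≤ γ₁(b)`, i.e. do not see
each other. -/
def wideGaps (θ δ : ℝ) (K : Set ℝ≥0) : Set ℝ≥0 :=
  ⋃₀ {I | (∃ x ∈ Kᶜ, I = connectedComponentIn Kᶜ x) ∧ BddAbove I ∧
    sInf I ≤ lowerEdge θ δ (sSup I)}

/-- The collection `{A_n(v)}`: the traces on `supp v` of the connected components of the complement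
of the wide gaps of `supp v`. -/
def blocks (θ δ : ℝ) (v : FiniteMeasure ℝ≥0) : Set (Set ℝ≥0) :=
  {A | ∃ x ∈ (wideGaps θ δ (v : Measure ℝ≥0).support)ᶜ,
    A = connectedComponentIn (wideGaps θ δ (v : Measure ℝ≥0).support)ᶜ x ∩
      (v : Measure ℝ≥0).support}

/-! ### Long time limit -/

/-- The time translate `t ↦ v(t + s)`. -/
def shift (s : ℝ≥0) (v : C(ℝ≥0, FiniteMeasure ℝ≥0)) : C(ℝ≥0, FiniteMeasure ℝ≥0) :=
  v.comp (ContinuousMap.addRight s)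

end

end Compton

namespace Compton

/-! ### Bounds for the redistribution function and the rate -/

/-! The rate is antisymmetric and nonnegative for `k ≤ k'`, so mass only moves towards lower
energies: `∫ φ dv(t)` is nonincreasing for every nondecreasing test function (`antitone_integral`).
Tails are therefore dominated by those of `v₀`, the trajectory stays in a compact set of measures,
and all cluster points coincide because integrals of smooth steps are monotone in time and determine
a measure of given mass (`exists_tendsto`). This gives the limit `μ`.

If two support points `k < k'` of `μ` had `Φ k k' ≠ 0`, the integral of a step placed between them
would decrease at a rate bounded away from zero for all large times, which is impossible for a
nonnegative quantity (`cutoff_eq_zero_of_lt`). As `Φ = 1` on the diagonal and `Φ` is continuous off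
the origin, positive support points of `μ` are isolated, so `μ` is a countable sum of atoms.

The support of `v₀` is not enlarged: a Gronwall argument with bumps supported off it works because
the rate is singular only at the origin (`exists_abs_rate_le`), which is treated separately
(`measure_compl_support`). Given this, points on opposite sides of a wide gap have zero rate
(`lowerEdge_lt`, `lowerEdge_mono`), so the mass on each side is conserved and every block keeps its
mass (`measureReal_Ioi_eq`, `limit_measure_block`). Downward motion with no leakage below a block
forces its positive minimum to remain charged (`isLeast_block_mem_support`). -/

lemma momentumTransfer_comm (k k' c : ℝ) :
    momentumTransfer k k' c = momentumTransfer k' k c := by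
  unfold momentumTransfer
  congr 1
  ring

lemma redistribution_comm (β m k k' : ℝ) :
    redistribution β m k k' = redistribution β m k' k := by
  unfold redistribution
  simp only [momentumTransfer_comm k k']
  rw [add_comm k k', show (k' - k) ^ 2 = (k - k') ^ 2 by ring]

lemma redistribution_nonneg (β m k k' : ℝ) : 0 ≤ redistribution β m k k' := by
  unfold redistribution
  refine mul_nonneg (by positivity) (intervalIntegral.integral_nonneg (by norm_num) ?_)
  intro c _
  have : 0 ≤ momentumTransfer k k' c := Real.sqrt_nonneg _
  positivity

lemma abs_sub_le_momentumTransfer {k k' c : ℝ} (hk : 0 ≤ k) (hk' : 0 ≤ k') (hc : c ≤ 1) :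
    |k' - k| ≤ momentumTransfer k k' c := by
  unfold momentumTransfer
  refine Real.abs_le_sqrt ?_
  nlinarith [mul_nonneg (mul_nonneg hk hk') (sub_nonneg.2 hc)]

lemma momentumTransfer_le_add {k k' c : ℝ} (hk : 0 ≤ k) (hk' : 0 ≤ k') (hc : -1 ≤ c) :
    momentumTransfer k k' c ≤ k + k' := by
  unfold momentumTransfer
  refine Real.sqrt_le_iff.2 ⟨by positivity, ?_⟩
  nlinarith [mul_nonneg (mul_nonneg hk hk') (neg_le_iff_add_nonneg.1 hc)]

/-- Separates a term in `d / r`, which lies between `0` and `m / 2` once `|d| ≤ r`, from a Gaussian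
in `r`. -/
lemma redistribution_exponent {β m d r : ℝ} (hm : 0 < m) (hr : 0 < r) :
    -β * ((d ^ 2 + m ^ 2 * (r / m) ^ 4 / 4) / (2 * m * (r / m) ^ 2)) =
      -β * (m * (d ^ 2 / r ^ 2) / 2 + r ^ 2 / (8 * m)) := by
  field_simp
  ring

/-- Uses `|k' - k| ≤ r` under the integral. The Gaussian is kept because it later absorbs
exponential growth in `|k' - k|`; the `4` is `1 + c ^ 2 ≤ 2` times the interval length. -/
lemma abs_redistribution_le {β m k k' : ℝ} (hβ : 0 < β) (hm : 0 < m) (hk : 0 ≤ k) (hk' : 0 ≤ k')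
    (hne : k ≠ k') :
    |redistribution β m k k'| ≤ Real.sqrt β * Real.exp (β * (k' + k) / 2) *
      (4 / |k' - k| * Real.exp (-β * ((k' - k) ^ 2 / (8 * m)))) := by
  have hd : 0 < |k' - k| := abs_pos.2 (sub_ne_zero.2 hne.symm)
  unfold redistribution
  rw [abs_mul, abs_of_nonneg (by positivity : 0 ≤ Real.sqrt β * Real.exp (β * (k' + k) / 2))]
  refine mul_le_mul_of_nonneg_left ?_ (by positivity)
  have key : ∀ c ∈ uIoc (-1 : ℝ) 1, ‖(1 + c ^ 2) / momentumTransfer k k' c *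
        Real.exp (-β * (((k' - k) ^ 2 + m ^ 2 * (momentumTransfer k k' c / m) ^ 4 / 4) /
          (2 * m * (momentumTransfer k k' c / m) ^ 2)))‖ ≤
      2 / |k' - k| * Real.exp (-β * ((k' - k) ^ 2 / (8 * m))) := by
    intro c hc
    rw [uIoc_of_le (by norm_num)] at hc
    have hr := abs_sub_le_momentumTransfer hk hk' hc.2
    have hr0 := hd.trans_le hr
    rw [Real.norm_of_nonneg (by positivity), redistribution_exponent hm hr0]
    have h1 : 1 + c ^ 2 ≤ 2 := by nlinarith [hc.1, hc.2]
    have h2 : (k' - k) ^ 2 ≤ momentumTransfer k k' c ^ 2 := by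
      rw [← sq_abs (k' - k)]
      gcongr
    have h3 : (k' - k) ^ 2 / (8 * m) ≤ momentumTransfer k k' c ^ 2 / (8 * m) := by gcongr
    have h4 : 0 ≤ m * ((k' - k) ^ 2 / momentumTransfer k k' c ^ 2) / 2 := by positivity
    have h5 : -β * (m * ((k' - k) ^ 2 / momentumTransfer k k' c ^ 2) / 2 +
        momentumTransfer k k' c ^ 2 / (8 * m)) ≤ -β * ((k' - k) ^ 2 / (8 * m)) := by
      nlinarith
    gcongr
  have := intervalIntegral.norm_integral_le_of_norm_le_const key
  rw [Real.norm_eq_abs] at this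
  refine this.trans (le_of_eq ?_)
  norm_num
  ring

/-- From `|k' - k| ≤ r ≤ k + k'`. The explicit bound is continuous for `k + k' > 0`, so local
positivity of the rate needs no continuity of `redistribution`. -/
lemma le_redistribution {β m k k' : ℝ} (hβ : 0 < β) (hm : 0 < m) (hk : 0 ≤ k) (hk' : 0 ≤ k')
    (hne : k ≠ k') :
    Real.sqrt β * (2 / (k + k') * Real.exp (-β * (m / 2 + (k + k') ^ 2 / (8 * m)))) ≤
      redistribution β m k k' := by
  have hd : 0 < |k' - k| := abs_pos.2 (sub_ne_zero.2 hne.symm)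
  have hrpos : ∀ c : ℝ, c ≤ 1 → 0 < momentumTransfer k k' c := fun c hc =>
    hd.trans_le (abs_sub_le_momentumTransfer hk hk' hc)
  have hcont : ContinuousOn (fun c : ℝ => (1 + c ^ 2) / momentumTransfer k k' c *
        Real.exp (-β * (((k' - k) ^ 2 + m ^ 2 * (momentumTransfer k k' c / m) ^ 4 / 4) /
          (2 * m * (momentumTransfer k k' c / m) ^ 2)))) (uIcc (-1) 1) := by
    have hr : Continuous fun c : ℝ => momentumTransfer k k' c := by
      unfold momentumTransfer
      fun_prop
    rw [uIcc_of_le (by norm_num)]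
    have h1 : ∀ c ∈ Icc (-1 : ℝ) 1, momentumTransfer k k' c ≠ 0 := fun c hc => (hrpos c hc.2).ne'
    have h2 : ∀ c ∈ Icc (-1 : ℝ) 1, 2 * m * (momentumTransfer k k' c / m) ^ 2 ≠ 0 := fun c hc => by
      have := hrpos c hc.2
      positivity
    have hr' := hr.continuousOn (s := Icc (-1 : ℝ) 1)
    exact ((by fun_prop : ContinuousOn (fun c : ℝ => 1 + c ^ 2) _).div hr' h1).mul
      (Real.continuous_exp.comp_continuousOn (continuousOn_const.mul
        (ContinuousOn.div (by fun_prop) (by fun_prop) h2)))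
  have key : ∀ c ∈ Icc (-1 : ℝ) 1, 1 / (k + k') * Real.exp (-β * (m / 2 + (k + k') ^ 2 / (8 * m)))
      ≤ (1 + c ^ 2) / momentumTransfer k k' c *
        Real.exp (-β * (((k' - k) ^ 2 + m ^ 2 * (momentumTransfer k k' c / m) ^ 4 / 4) /
          (2 * m * (momentumTransfer k k' c / m) ^ 2))) := by
    intro c hc
    have hr := abs_sub_le_momentumTransfer hk hk' hc.2
    have hr2 := momentumTransfer_le_add hk hk' hc.1
    have hr0 := hrpos c hc.2
    rw [redistribution_exponent hm hr0]
    have h2 : (k' - k) ^ 2 / momentumTransfer k k' c ^ 2 ≤ 1 := by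
      rw [div_le_one (by positivity), ← sq_abs (k' - k)]
      gcongr
    have h3 : momentumTransfer k k' c ^ 2 / (8 * m) ≤ (k + k') ^ 2 / (8 * m) := by gcongr
    have h5 : -β * (m / 2 + (k + k') ^ 2 / (8 * m)) ≤
        -β * (m * ((k' - k) ^ 2 / momentumTransfer k k' c ^ 2) / 2 +
        momentumTransfer k k' c ^ 2 / (8 * m)) := by
      have : m * ((k' - k) ^ 2 / momentumTransfer k k' c ^ 2) ≤ m * 1 := by gcongr
      nlinarith
    have h6 : 1 ≤ 1 + c ^ 2 := by nlinarith [sq_nonneg c]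
    have h7 : 0 ≤ k + k' := by positivity
    gcongr
  have hint := intervalIntegral.integral_mono_on (by norm_num : (-1 : ℝ) ≤ 1)
    (intervalIntegrable_const (μ := volume)) hcont.intervalIntegrable key
  rw [intervalIntegral.integral_const, smul_eq_mul] at hint
  unfold redistribution
  have h1 : 1 ≤ Real.exp (β * (k' + k) / 2) := Real.one_le_exp (by positivity)
  have h0 : 0 ≤ 2 / (k + k') * Real.exp (-β * (m / 2 + (k + k') ^ 2 / (8 * m))) := by positivity
  calc _ ≤ Real.sqrt β * Real.exp (β * (k' + k) / 2) *
        (2 / (k + k') * Real.exp (-β * (m / 2 + (k + k') ^ 2 / (8 * m)))) := by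
        gcongr
        exact le_mul_of_one_le_right (Real.sqrt_nonneg _) h1
    _ ≤ _ := by
        refine mul_le_mul_of_nonneg_left (le_of_eq_of_le ?_ hint) (by positivity)
        ring

lemma rate_zero_left (β m : ℝ) (Φ : ℝ≥0 → ℝ≥0 → ℝ) (k : ℝ≥0) : rate β m Φ 0 k = 0 := by
  simp [rate]

lemma rate_zero_right (β m : ℝ) (Φ : ℝ≥0 → ℝ≥0 → ℝ) (k : ℝ≥0) : rate β m Φ k 0 = 0 := by
  simp [rate]

lemma rate_eq_zero {β m : ℝ} {Φ : ℝ≥0 → ℝ≥0 → ℝ} {k k' : ℝ≥0} (h : Φ k k' = 0) :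
    rate β m Φ k k' = 0 := by
  simp [rate, h]

lemma IsCutoff.rate_antisymm {θ δ : ℝ} {Φ : ℝ≥0 → ℝ≥0 → ℝ} (hΦ : IsCutoff θ δ Φ) (β m : ℝ)
    (k k' : ℝ≥0) : rate β m Φ k k' = -rate β m Φ k' k := by
  unfold rate
  rw [redistribution_comm, hΦ.symm, mul_comm (k : ℝ) k']
  ring

lemma IsCutoff.rate_nonneg {θ δ : ℝ} {Φ : ℝ≥0 → ℝ≥0 → ℝ} (hΦ : IsCutoff θ δ Φ) {β : ℝ}
    (hβ : 0 < β) (m : ℝ) {k k' : ℝ≥0} (hk : k ≤ k') : 0 ≤ rate β m Φ k k' := by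
  have hk' : (k : ℝ) ≤ k' := hk
  have h : Real.exp (-β * k') ≤ Real.exp (-β * k) := Real.exp_le_exp.2 (by nlinarith)
  exact mul_nonneg (sub_nonneg.2 h) (div_nonneg
    (mul_nonneg (redistribution_nonneg _ _ _ _) (hΦ.nonneg _ _)) (by positivity))

/-- The symmetric prefactor of `redistribution` turns the difference of exponentials into `2 sinh
(|y - x| / 2)`, so only the distance between the energies matters. -/
lemma abs_exp_sub_exp_le (x y : ℝ) :
    |Real.exp (-x) - Real.exp (-y)| * Real.exp ((y + x) / 2) ≤ |y - x| * Real.exp (|y - x| / 2) := by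
  wlog h : x ≤ y generalizing x y
  · have := this y x (le_of_not_ge h)
    rwa [abs_sub_comm, abs_sub_comm y x, add_comm y x]
  have h1 : Real.exp (-y) ≤ Real.exp (-x) := Real.exp_le_exp.2 (by linarith)
  rw [abs_of_nonneg (sub_nonneg.2 h1), abs_of_nonneg (sub_nonneg.2 h), sub_mul, ← Real.exp_add,
    ← Real.exp_add]
  have h2 : Real.exp (-y + (y + x) / 2) = Real.exp (-(y - x)) * Real.exp ((y - x) / 2) := by
    rw [← Real.exp_add]
    congr 1
    ring
  rw [h2, show -x + (y + x) / 2 = (y - x) / 2 by ring]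
  nlinarith [Real.add_one_le_exp (-(y - x)), Real.exp_pos ((y - x) / 2)]

/-- The factor `d` from the exponentials cancels `1 / d`, leaving the singularity `1 / (k k')`. -/
lemma IsCutoff.abs_rate_le {θ δ : ℝ} {Φ : ℝ≥0 → ℝ≥0 → ℝ} (hΦ : IsCutoff θ δ Φ) {β m : ℝ}
    (hβ : 0 < β) (hm : 0 < m) (k k' : ℝ≥0) :
    |rate β m Φ k k'| ≤ 4 * β * Real.sqrt β * Real.exp (β * m / 2) / (k * k') := by
  rcases eq_or_ne k k' with rfl | hne
  · simp only [rate, sub_self, zero_mul, abs_zero]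
    positivity
  have hne' : (k : ℝ) ≠ k' := fun h => hne (NNReal.coe_injective h)
  have hd : 0 < |(k' : ℝ) - k| := abs_pos.2 (sub_ne_zero.2 hne'.symm)
  set d := |(k' : ℝ) - k| with hd_def
  have hB := abs_redistribution_le hβ hm k.2 k'.2 hne'
  have hE := abs_exp_sub_exp_le (β * k) (β * k')
  have hβd : |β * (k' : ℝ) - β * k| = β * d := by
    rw [← mul_sub, abs_mul, abs_of_pos hβ]
  rw [hβd] at hE
  unfold rate
  rw [abs_mul, abs_div, abs_mul, abs_of_nonneg (hΦ.nonneg k k'),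
    abs_of_nonneg (by positivity : (0 : ℝ) ≤ k * k'), ← mul_div_assoc]
  refine div_le_div_of_nonneg_right ?_ (by positivity)
  have hsq : ((k' : ℝ) - k) ^ 2 = d ^ 2 := (sq_abs _).symm
  simp only [NNReal.val_eq_coe, ← hd_def, hsq] at hB
  calc |Real.exp (-β * k) - Real.exp (-β * k')| * (|redistribution β m k k'| * Φ k k')
      ≤ |Real.exp (-(β * k)) - Real.exp (-(β * k'))| *
          (Real.sqrt β * Real.exp ((β * k' + β * k) / 2) *
            (4 / d * Real.exp (-β * (d ^ 2 / (8 * m))))) := by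
        rw [neg_mul, neg_mul]
        refine mul_le_mul_of_nonneg_left ?_ (abs_nonneg _)
        rw [← mul_add]
        exact (mul_le_of_le_one_right (abs_nonneg _) (hΦ.le_one _ _)).trans hB
    _ = (|Real.exp (-(β * k)) - Real.exp (-(β * k'))| * Real.exp ((β * k' + β * k) / 2)) *
          (Real.sqrt β * (4 / d * Real.exp (-β * (d ^ 2 / (8 * m))))) := by ring
    _ ≤ (β * d * Real.exp (β * d / 2)) *
          (Real.sqrt β * (4 / d * Real.exp (-β * (d ^ 2 / (8 * m))))) := by gcongr
    _ = 4 * β * Real.sqrt β * Real.exp (β * d / 2 + -β * (d ^ 2 / (8 * m))) := by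
        rw [Real.exp_add]
        field_simp
    _ ≤ _ := by
        gcongr
        -- Completing the square: `d / 2 - d ^ 2 / (8 m)` is largest at `d = 2 m`, with value `m /
        -- 2`.
        have : 0 ≤ β * ((d - 2 * m) ^ 2 / (8 * m)) := by positivity
        have h2 : (d - 2 * m) ^ 2 / (8 * m) = d ^ 2 / (8 * m) - d / 2 + m / 2 := by
          field_simp
          ring
        rw [h2] at this
        linarith

/-- The rate is locally bounded below by a positive constant where `Φ > 0` and `0 < k < k'`. -/
lemma IsCutoff.exists_le_rate {θ δ : ℝ} {Φ : ℝ≥0 → ℝ≥0 → ℝ} (hΦ : IsCutoff θ δ Φ) {β m : ℝ}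
    (hβ : 0 < β) (hm : 0 < m) {k₀ k₀' : ℝ≥0} (h0 : 0 < k₀) (hlt : k₀ < k₀') (hpos : Φ k₀ k₀' ≠ 0) :
    ∃ c > 0, ∀ᶠ p : ℝ≥0 × ℝ≥0 in 𝓝 (k₀, k₀'), c ≤ rate β m Φ p.1 p.2 := by
  -- The rate with `redistribution` replaced by its continuous lower bound.
  set f : ℝ≥0 × ℝ≥0 → ℝ := fun p => (Real.exp (-β * p.1) - Real.exp (-β * p.2)) *
    (Real.sqrt β * (2 / ((p.1 : ℝ) + p.2) *
      Real.exp (-β * (m / 2 + ((p.1 : ℝ) + p.2) ^ 2 / (8 * m)))) * Φ p.1 p.2 /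
        ((p.1 : ℝ) * p.2)) with hf
  have h0' : (0 : ℝ) < k₀ := h0
  have hlt' : (k₀ : ℝ) < k₀' := hlt
  have hk0' : (0 : ℝ) < k₀' := h0'.trans hlt'
  have hcontΦ : ContinuousAt (fun p : ℝ≥0 × ℝ≥0 => Φ p.1 p.2) (k₀, k₀') :=
    hΦ.continuousOn.continuousAt (isOpen_compl_singleton.mem_nhds (by simp [h0.ne']))
  have h1 : ContinuousAt (fun p : ℝ≥0 × ℝ≥0 => (p.1 : ℝ)) (k₀, k₀') := by fun_prop
  have h2 : ContinuousAt (fun p : ℝ≥0 × ℝ≥0 => (p.2 : ℝ)) (k₀, k₀') := by fun_prop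
  have hcont : ContinuousAt f (k₀, k₀') := by
    refine ContinuousAt.mul (by fun_prop) (ContinuousAt.div (ContinuousAt.mul ?_ hcontΦ)
      (h1.mul h2) (by positivity))
    refine continuousAt_const.mul (ContinuousAt.mul ?_ (by fun_prop))
    exact continuousAt_const.div (h1.add h2) (by positivity)
  have hfpos : 0 < f (k₀, k₀') := by
    have : Real.exp (-β * k₀') < Real.exp (-β * k₀) := Real.exp_lt_exp.2 (by nlinarith)
    have h3 := sub_pos.2 this
    have h4 : 0 < Φ k₀ k₀' := (hΦ.nonneg _ _).lt_of_ne' hpos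
    simp only [hf]
    positivity
  refine ⟨f (k₀, k₀') / 2, by positivity, ?_⟩
  have hlt2 : ∀ᶠ p : ℝ≥0 × ℝ≥0 in 𝓝 (k₀, k₀'), p.1 < p.2 :=
    (isOpen_lt continuous_fst continuous_snd).mem_nhds hlt
  filter_upwards [hcont.eventually (lt_mem_nhds (half_lt_self hfpos)), hlt2] with p hp hp2
  refine hp.le.trans ?_
  have hp2' : (p.1 : ℝ) < p.2 := hp2
  have h3 : Real.exp (-β * p.2) ≤ Real.exp (-β * p.1) := Real.exp_le_exp.2 (by nlinarith)
  have h4 := le_redistribution hβ hm p.1.2 p.2.2 hp2'.ne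
  refine mul_le_mul_of_nonneg_left ?_ (sub_nonneg.2 h3)
  refine div_le_div_of_nonneg_right ?_ (by positivity)
  exact mul_le_mul_of_nonneg_right h4 (hΦ.nonneg _ _)

/-! ### Test functions -/

lemma IsTest.continuous_comp_coe {φ : ℝ → ℝ} (hφ : IsTest φ) :
    Continuous fun k : ℝ≥0 => φ k :=
  hφ.contDiffOn.continuousOn.comp_continuous NNReal.continuous_coe fun k => k.2

/-- A test function as a bounded continuous function on `[0, ∞)`. -/
noncomputable def IsTest.toBCF {φ : ℝ → ℝ} (hφ : IsTest φ) : BoundedContinuousFunction ℝ≥0 ℝ :=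
  BoundedContinuousFunction.ofNormedAddCommGroup (fun k : ℝ≥0 => φ k) hφ.continuous_comp_coe
    hφ.bounded.choose fun k => hφ.bounded.choose_spec k k.2

lemma IsTest.integrable {φ : ℝ → ℝ} (hφ : IsTest φ) (ν : Measure ℝ≥0) [IsFiniteMeasure ν] :
    Integrable (fun k : ℝ≥0 => φ k) ν :=
  hφ.toBCF.integrable ν

lemma IsTest.tendsto_integral {φ : ℝ → ℝ} (hφ : IsTest φ) {v : C(ℝ≥0, FiniteMeasure ℝ≥0)}
    {μ : FiniteMeasure ℝ≥0} (h : Tendsto v atTop (𝓝 μ)) :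
    Tendsto (fun t => ∫ k : ℝ≥0, φ k ∂(v t : Measure ℝ≥0)) atTop
      (𝓝 (∫ k : ℝ≥0, φ k ∂(μ : Measure ℝ≥0))) :=
  FiniteMeasure.tendsto_iff_forall_integral_tendsto.1 h hφ.toBCF

lemma isTest_of_contDiff {φ : ℝ → ℝ} (hφ : ContDiff ℝ 1 φ) (h0 : ∀ x ≤ 0, φ x = φ 0) {N : ℝ}
    (hN : ∀ x, N ≤ x → φ x = φ N) : IsTest φ := by
  have hdw : ∀ x ∈ Ici (0 : ℝ), derivWithin φ (Ici 0) x = deriv φ x := fun x hx =>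
    (hφ.differentiable one_ne_zero x).derivWithin (uniqueDiffOn_Ici 0 x hx)
  refine ⟨hφ.contDiffOn, ?_, ?_, ?_⟩
  · obtain ⟨C, hC⟩ := isCompact_Icc.exists_bound_of_continuousOn
      (hφ.continuous.continuousOn (s := Icc 0 (max N 0)))
    refine ⟨C, fun x hx => ?_⟩
    rcases le_total x (max N 0) with h | h
    · exact hC x ⟨hx, h⟩
    · rw [hN x ((le_max_left _ _).trans h), ← hN (max N 0) (le_max_left _ _)]
      exact hC _ ⟨le_max_right _ _, le_rfl⟩
  · obtain ⟨C, hC⟩ := isCompact_Icc.exists_bound_of_continuousOn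
      ((hφ.continuous_deriv le_rfl).continuousOn (s := Icc 0 N))
    refine ⟨max C 0, fun x hx => ?_⟩
    rw [hdw x hx]
    rcases le_or_gt x N with h | h
    · exact (hC x ⟨hx, h⟩).trans (le_max_left _ _)
    · have : φ =ᶠ[𝓝 x] fun _ => φ N := by
        filter_upwards [lt_mem_nhds h] with y hy using hN y hy.le
      rw [this.deriv_eq]
      simp
  -- The derivative at `0` is computed from the left, where `φ` is constant.
  · rw [hdw 0 self_mem_Ici,
      ← (hφ.differentiable one_ne_zero 0).derivWithin (uniqueDiffOn_Iic 0 0 self_mem_Iic),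
      derivWithin_congr (f := fun _ => φ 0) (s := Iic 0) (fun x hx => h0 x hx) rfl]
    simp

/-- A smooth monotone function equal to `0` on `(-∞, a]` and to `1` on `[b, ∞)`. -/
noncomputable def step (a b x : ℝ) : ℝ := Real.smoothTransition ((x - a) / (b - a))

lemma step_nonneg (a b x : ℝ) : 0 ≤ step a b x := Real.smoothTransition.nonneg _

lemma step_le_one (a b x : ℝ) : step a b x ≤ 1 := Real.smoothTransition.le_one _

lemma step_eq_zero {a b x : ℝ} (hab : a < b) (hx : x ≤ a) : step a b x = 0 :=
  Real.smoothTransition.zero_of_nonpos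
    (div_nonpos_of_nonpos_of_nonneg (sub_nonpos.2 hx) (sub_nonneg.2 hab.le))

lemma step_eq_one {a b x : ℝ} (hab : a < b) (hx : b ≤ x) : step a b x = 1 :=
  Real.smoothTransition.one_of_one_le ((one_le_div (sub_pos.2 hab)).2 (by linarith))

lemma step_pos {a b x : ℝ} (hab : a < b) (hx : a < x) : 0 < step a b x :=
  Real.smoothTransition.pos_of_pos (div_pos (sub_pos.2 hx) (sub_pos.2 hab))

lemma step_lt_one {a b x : ℝ} (hab : a < b) (hx : x < b) : step a b x < 1 :=
  Real.smoothTransition.lt_one_of_lt_one ((div_lt_one (sub_pos.2 hab)).2 (by linarith))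

lemma step_monotone {a b : ℝ} (hab : a < b) : Monotone (step a b) := fun _ _ hxy =>
  Real.smoothTransition.monotone
    (div_le_div_of_nonneg_right (sub_le_sub_right hxy a) (sub_nonneg.2 hab.le))

lemma contDiff_step (a b : ℝ) : ContDiff ℝ 1 (step a b) :=
  (Real.smoothTransition.contDiff (n := 1)).comp (by fun_prop)

lemma isTest_step {a b : ℝ} (ha : 0 ≤ a) (hab : a < b) : IsTest (step a b) :=
  isTest_of_contDiff (contDiff_step a b)
    (fun x hx => by rw [step_eq_zero hab (hx.trans ha), step_eq_zero hab ha]) (N := b)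
    (fun x hx => by rw [step_eq_one hab hx, step_eq_one hab le_rfl])

/-- A smooth function with values in `[0, 1]` which is positive exactly on `(a, b)`. -/
noncomputable def bump (a b x : ℝ) : ℝ := step a ((a + b) / 2) x * (1 - step ((a + b) / 2) b x)

lemma bump_nonneg (a b x : ℝ) : 0 ≤ bump a b x :=
  mul_nonneg (step_nonneg _ _ _) (sub_nonneg.2 (step_le_one _ _ _))

lemma bump_le_one (a b x : ℝ) : bump a b x ≤ 1 :=
  mul_le_one₀ (step_le_one _ _ _) (sub_nonneg.2 (step_le_one _ _ _))
    (sub_le_self _ (step_nonneg _ _ _))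

lemma bump_pos {a b x : ℝ} (hx : x ∈ Ioo a b) : 0 < bump a b x :=
  have hab := hx.1.trans hx.2
  mul_pos (step_pos (by linarith) hx.1) (sub_pos.2 (step_lt_one (by linarith) hx.2))

lemma bump_eq_zero {a b x : ℝ} (hab : a < b) (hx : x ∉ Ioo a b) : bump a b x = 0 := by
  unfold bump
  rcases le_or_gt x a with h | h
  · rw [step_eq_zero (by linarith) h, zero_mul]
  · have : b ≤ x := not_lt.1 fun h' => hx ⟨h, h'⟩
    rw [step_eq_one (by linarith) this, sub_self, mul_zero]

lemma isTest_bump {a b : ℝ} (ha : 0 ≤ a) (hab : a < b) : IsTest (bump a b) := by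
  refine isTest_of_contDiff ((contDiff_step _ _).mul (contDiff_const.sub (contDiff_step _ _)))
    (fun x hx => ?_) (N := b) (fun x hx => ?_)
  · rw [bump_eq_zero hab fun h => (hx.trans ha).not_gt h.1, bump_eq_zero hab fun h => ha.not_gt h.1]
  · rw [bump_eq_zero hab fun h => hx.not_gt h.2, bump_eq_zero hab fun h => h.2.false]

/-! ### Measures on `[0, ∞)` and test functions -/

lemma integral_bump_eq_zero {ν : Measure ℝ≥0} {a b : ℝ} (hab : a < b)
    (h : ν {k : ℝ≥0 | (k : ℝ) ∈ Ioo a b} = 0) : ∫ k : ℝ≥0, bump a b k ∂ν = 0 := by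
  refine integral_eq_zero_of_ae ?_
  filter_upwards [measure_eq_zero_iff_ae_notMem.1 h] with k hk using bump_eq_zero hab hk

lemma measure_eq_zero_of_integral_bump {ν : Measure ℝ≥0} [IsFiniteMeasure ν] {a b : ℝ}
    (ha : 0 ≤ a) (hab : a < b) (h : ∫ k : ℝ≥0, bump a b k ∂ν = 0) :
    ν {k : ℝ≥0 | (k : ℝ) ∈ Ioo a b} = 0 := by
  rw [integral_eq_zero_iff_of_nonneg (fun k => bump_nonneg _ _ _)
    ((isTest_bump ha hab).integrable ν)] at h
  rw [measure_eq_zero_iff_ae_notMem]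
  filter_upwards [h] with k hk hmem using (bump_pos hmem).ne' hk

lemma integral_bump_pos {ν : Measure ℝ≥0} [IsFiniteMeasure ν] {a b : ℝ} (ha : 0 ≤ a) {x : ℝ≥0}
    (hx : x ∈ ν.support) (hmem : (x : ℝ) ∈ Ioo a b) : 0 < ∫ k : ℝ≥0, bump a b k ∂ν := by
  have hnn : 0 ≤ ∫ k : ℝ≥0, bump a b k ∂ν := integral_nonneg fun k => bump_nonneg a b k
  refine hnn.lt_of_ne' fun h => ?_
  have h0 := measure_eq_zero_of_integral_bump ha (hmem.1.trans hmem.2) h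
  exact ((Measure.mem_support_iff_forall x).1 hx _
    ((isOpen_Ioo.preimage NNReal.continuous_coe).mem_nhds hmem)).ne' h0

/-- The mass of `(x, ∞)` is the limit of the integrals of smooth steps. -/
lemma tendsto_integral_step (ν : Measure ℝ≥0) [IsFiniteMeasure ν] (x : ℝ≥0) :
    Tendsto (fun n : ℕ => ∫ k : ℝ≥0, step x (x + 1 / ((n : ℝ) + 1)) k ∂ν) atTop
      (𝓝 (ν.real (Ioi x))) := by
  have hlt : ∀ n : ℕ, (x : ℝ) < x + 1 / ((n : ℝ) + 1) := fun n => by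
    have : (0 : ℝ) < 1 / ((n : ℝ) + 1) := by positivity
    linarith
  rw [← integral_indicator_one measurableSet_Ioi]
  refine tendsto_integral_of_dominated_convergence (fun _ => 1)
    (fun n => ((isTest_step x.2 (hlt n)).integrable ν).aestronglyMeasurable)
    (integrable_const _) (fun n => Eventually.of_forall fun k => ?_)
    (Eventually.of_forall fun k => ?_)
  · rw [Real.norm_of_nonneg (step_nonneg _ _ _)]
    exact step_le_one _ _ _
  · rcases le_or_gt k x with h | h
    · rw [indicator_of_notMem (by simpa using h)]
      have : ∀ n : ℕ, step x (x + 1 / ((n : ℝ) + 1)) k = 0 := fun n => step_eq_zero (hlt n) h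
      simp only [this]
      exact tendsto_const_nhds
    · rw [indicator_of_mem (by simpa using h)]
      have h' : (0 : ℝ) < k - x := sub_pos.2 h
      refine tendsto_const_nhds.congr' ?_
      filter_upwards [(tendsto_one_div_add_atTop_nhds_zero_nat (𝕜 := ℝ)).eventually
        (gt_mem_nhds h')] with n hn
      rw [step_eq_one (hlt n) (by linarith)]
      rfl

lemma measureReal_Ioi_le_of_integral_step_le {μ ν : Measure ℝ≥0} [IsFiniteMeasure μ]
    [IsFiniteMeasure ν]
    (h : ∀ a b : ℝ, 0 ≤ a → a < b → ∫ k : ℝ≥0, step a b k ∂μ ≤ ∫ k : ℝ≥0, step a b k ∂ν)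
    (x : ℝ≥0) : μ.real (Ioi x) ≤ ν.real (Ioi x) :=
  le_of_tendsto_of_tendsto' (tendsto_integral_step μ x) (tendsto_integral_step ν x) fun n =>
    h _ _ x.2 (by
      have : (0 : ℝ) < 1 / ((n : ℝ) + 1) := by positivity
      linarith)

/-- Two finite measures of the same mass with the same integrals of smooth steps agree. -/
lemma eq_of_integral_step_eq {μ ν : FiniteMeasure ℝ≥0} (hm : μ.mass = ν.mass)
    (h : ∀ a b : ℝ, 0 ≤ a → a < b →
      ∫ k : ℝ≥0, step a b k ∂(μ : Measure ℝ≥0) = ∫ k : ℝ≥0, step a b k ∂(ν : Measure ℝ≥0)) :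
    μ = ν := by
  refine FiniteMeasure.toMeasure_injective (Measure.ext_of_Iic _ _ fun x => ?_)
  have hI : (μ : Measure ℝ≥0).real (Ioi x) = (ν : Measure ℝ≥0).real (Ioi x) :=
    le_antisymm (measureReal_Ioi_le_of_integral_step_le (fun a b ha hab => (h a b ha hab).le) x)
      (measureReal_Ioi_le_of_integral_step_le (fun a b ha hab => (h a b ha hab).ge) x)
  have hI' : (μ : Measure ℝ≥0) (Ioi x) = (ν : Measure ℝ≥0) (Ioi x) :=
    (measureReal_eq_measureReal_iff).1 hI
  have huniv : (μ : Measure ℝ≥0) univ = (ν : Measure ℝ≥0) univ := by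
    rw [← FiniteMeasure.ennreal_mass, ← FiniteMeasure.ennreal_mass, hm]
  rw [← compl_Ioi, measure_compl measurableSet_Ioi (measure_ne_top _ _),
    measure_compl measurableSet_Ioi (measure_ne_top _ _), hI', huniv]

/-- A criterion for a measure to be carried by a closed set, in terms of the bumps of its
complement. -/
lemma measure_compl_eq_zero_of_bump {K : Set ℝ≥0} (hK : IsClosed K) {ν : Measure ℝ≥0}
    [IsFiniteMeasure ν]
    (h : ∀ a b : ℝ, 0 < a → a < b → (∀ k ∈ K, (k : ℝ) ∉ Ioo a b) → ∫ k : ℝ≥0, bump a b k ∂ν = 0) :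
    ν (Kᶜ ∩ Ioi 0) = 0 := by
  refine measure_null_of_locally_null _ fun x hx => ?_
  have hx0 : (0 : ℝ) < x := hx.2
  have hmem : Kᶜ ∩ Ioi 0 ∈ 𝓝 x := (hK.isOpen_compl.inter isOpen_Ioi).mem_nhds hx
  obtain ⟨a, b, hab, hsub⟩ := (mem_nhds_iff_exists_Ioo_subset' ⟨0, hx.2⟩ ⟨x + 1, by simp⟩).1 hmem
  -- The endpoint `a` may be `0`, whereas `h` requires a positive one.
  obtain ⟨c, hac, hcx⟩ := exists_between hab.1
  have hc0 : (0 : ℝ) < c := NNReal.coe_pos.2 (zero_le.trans_lt hac)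
  have hlt : (c : ℝ) < b := hcx.trans hab.2
  have hset : {k : ℝ≥0 | (k : ℝ) ∈ Ioo (c : ℝ) b} = Ioo c b := by
    ext k
    simp
  refine ⟨Ioo c b, mem_nhdsWithin_of_mem_nhds (Ioo_mem_nhds hcx hab.2), ?_⟩
  rw [← hset]
  refine measure_eq_zero_of_integral_bump hc0.le hlt (h c b hc0 hlt fun k hk hkm => ?_)
  have hkm' : k ∈ Ioo c b := by simpa using hkm
  exact (hsub ⟨hac.trans hkm'.1, hkm'.2⟩).1 hk

/-! ### Functions with a bound on the derivative almost everywhere -/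

/-- The weak equation holds only at almost every time, so growth bounds rest on absolute continuity.
-/
lemma sub_le_of_ae_deriv_le {g : ℝ → ℝ} {s t c : ℝ} (hst : s ≤ t)
    (hg : AbsolutelyContinuousOnInterval g s t)
    (hd : ∀ᵐ x : ℝ, x ∈ Ioc s t → deriv g x ≤ c) : g t - g s ≤ c * (t - s) := by
  rw [← hg.integral_deriv_eq_sub, intervalIntegral.integral_of_le hst]
  have hint := (intervalIntegrable_iff_integrableOn_Ioc_of_le hst).1 hg.intervalIntegrable_deriv
  calc ∫ x in Ioc s t, deriv g x ≤ ∫ _ in Ioc s t, c :=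
        setIntegral_mono_on_ae hint (by simp) measurableSet_Ioc hd
    _ = c * (t - s) := by simp [hst, mul_comm]

/-! ### Geometry of the interaction region -/

lemma rhoStar_nonneg {θ δ : ℝ} (hθ1 : θ < 1) : 0 ≤ rhoStar θ δ :=
  div_nonneg (by linarith) (Real.sqrt_nonneg _)

/-- Both `(x - y) / x` and `(x - y) / (x + y)` increase with `x`, hence so does `(x - y) ^ 2 / (x y
(x + y))`. -/
lemma sub_le_mul_sqrt_of_le {ρ x b y : ℝ} (hρ : 0 ≤ ρ) (hy : 0 ≤ y) (hyb : y ≤ b) (hbx : b ≤ x)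
    (h : x - y ≤ ρ * Real.sqrt (x * y * (x + y))) :
    b - y ≤ ρ * Real.sqrt (b * y * (b + y)) := by
  have hb : 0 ≤ b := hy.trans hyb
  rcases (hb.trans hbx).eq_or_lt with hx | hx
  · have : b - y ≤ 0 := by linarith
    exact this.trans (by positivity)
  have h1 : (x - y) ^ 2 ≤ ρ ^ 2 * (x * y * (x + y)) := by
    rw [← Real.sq_sqrt (by positivity : 0 ≤ x * y * (x + y)), ← mul_pow]
    exact pow_le_pow_left₀ (by linarith) h 2
  have h2 : (b - y) * x ≤ (x - y) * b := by nlinarith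
  have h3 : (b - y) * (x + y) ≤ (x - y) * (b + y) := by nlinarith
  have h4 : (b - y) * x * ((b - y) * (x + y)) ≤ (x - y) * b * ((x - y) * (b + y)) :=
    mul_le_mul h2 h3 (mul_nonneg (by linarith) (by linarith))
      (mul_nonneg (by linarith) hb)
  have h5 : (x - y) ^ 2 * (b * (b + y)) ≤ ρ ^ 2 * (x * y * (x + y)) * (b * (b + y)) :=
    mul_le_mul_of_nonneg_right h1 (by positivity)
  have h6 : (b - y) ^ 2 ≤ ρ ^ 2 * (b * y * (b + y)) := by
    refine le_of_mul_le_mul_right ?_ (by positivity : 0 < x * (x + y))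
    nlinarith
  refine (Real.le_sqrt_of_sq_le h6).trans (le_of_eq ?_)
  rw [Real.sqrt_mul (sq_nonneg ρ), Real.sqrt_sq hρ]

/-- `rhoStar` is chosen to give equality at `y = θ * δ`, where the curve meets the cone; increasing
`y` only helps. -/
lemma sub_le_rhoStar_mul_sqrt {θ δ y : ℝ} (hθ : 0 < θ) (hθ1 : θ < 1) (hδ : 0 < δ)
    (hy : θ * δ ≤ y) : δ - y ≤ rhoStar θ δ * Real.sqrt (δ * y * (δ + y)) := by
  have hs : 0 < Real.sqrt (δ * θ * (1 + θ)) := Real.sqrt_pos.2 (by positivity)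
  have h1 : δ * Real.sqrt (δ * θ * (1 + θ)) ≤ Real.sqrt (δ * y * (δ + y)) := by
    rw [← Real.sqrt_sq hδ.le, ← Real.sqrt_mul (sq_nonneg _), Real.sqrt_sq hδ.le]
    refine Real.sqrt_le_sqrt ?_
    calc δ ^ 2 * (δ * θ * (1 + θ)) = δ * (θ * δ) * (δ + θ * δ) := by ring
      _ ≤ δ * y * (δ + y) := by
        have : 0 < θ * δ := by positivity
        have : 0 < y := this.trans_le hy
        gcongr
  calc δ - y ≤ (1 - θ) * δ := by linarith
    _ = rhoStar θ δ * (δ * Real.sqrt (δ * θ * (1 + θ))) := by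
      unfold rhoStar
      field_simp
    _ ≤ _ := mul_le_mul_of_nonneg_left h1 (rhoStar_nonneg hθ1)

/-- Moving towards the diagonal does not leave the region; this is what makes `lowerEdge` monotone.
-/
lemma mk_mem_interactionRegion_of_le {θ δ : ℝ} (hθ : 0 < θ) (hθ1 : θ < 1) (hδ : 0 < δ)
    {x b y : ℝ≥0} (hyb : y ≤ b) (hbx : b ≤ x) (h : (x, y) ∈ interactionRegion θ δ) :
    (b, y) ∈ interactionRegion θ δ := by
  have hyb' : (y : ℝ) ≤ b := hyb
  have hbx' : (b : ℝ) ≤ x := hbx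
  have hρ : 0 ≤ rhoStar θ δ := rhoStar_nonneg hθ1
  obtain ⟨h1, h2⟩ := h
  dsimp only at h1 h2
  refine ⟨fun hb => ?_, fun hb => ?_⟩
  · dsimp only at hb ⊢
    rw [abs_of_nonneg (sub_nonneg.2 hyb')]
    by_cases hx : (x : ℝ) ≤ δ
    · have h3 := h1 ⟨hx, hb.2⟩
      rw [abs_of_nonneg (by linarith)] at h3
      exact sub_le_mul_sqrt_of_le hρ y.2 hyb' hbx' h3
    -- Mixed case `b ≤ δ < x`: the cone condition at `x` gives the curve condition at `(δ, y)`,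
    -- which then descends to `(b, y)`.
    · have h3 := (h2 fun h => hx h.1).1
      refine sub_le_mul_sqrt_of_le hρ y.2 hyb' hb.1 (sub_le_rhoStar_mul_sqrt hθ hθ1 hδ ?_)
      nlinarith
  · dsimp only at hb ⊢
    have h3 : ¬ ((x : ℝ) ≤ δ ∧ (y : ℝ) ≤ δ) := fun h => hb ⟨hbx'.trans h.1, h.2⟩
    have h4 := h2 h3
    refine ⟨(mul_le_mul_of_nonneg_left hbx' hθ.le).trans h4.1, hyb'.trans ?_⟩
    exact le_mul_of_one_le_left b.2 ((one_le_inv₀ hθ).2 hθ1.le)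

lemma diag_mem_region {θ δ ρ : ℝ} (hθ : 0 < θ) (hθ1 : θ < 1) (hρ : 0 ≤ ρ) (x : ℝ≥0) :
    (x, x) ∈ region θ δ ρ := by
  refine ⟨fun _ => ?_, fun _ => ⟨?_, ?_⟩⟩
  · simp only [sub_self, abs_zero]
    positivity
  · exact mul_le_of_le_one_left x.2 hθ1.le
  · exact le_mul_of_one_le_left x.2 ((one_le_inv₀ hθ).2 hθ1.le)

lemma mk_zero_notMem_interactionRegion {θ δ : ℝ} (hθ : 0 < θ) {x : ℝ≥0} (hx : 0 < x) :
    (x, 0) ∉ interactionRegion θ δ := by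
  have hx' : (0 : ℝ) < x := hx
  rintro ⟨h1, h2⟩
  by_cases h : ((x : ℝ) ≤ δ ∧ ((0 : ℝ≥0) : ℝ) ≤ δ)
  · have := h1 h
    simp only [NNReal.coe_zero, mul_zero, zero_mul, Real.sqrt_zero, sub_zero, NNReal.abs_eq] at this
    exact hx'.not_ge this
  · have := (h2 h).1
    simp only [NNReal.coe_zero] at this
    nlinarith

/-- Being a topological support makes the region closed without inspecting its piecewise formula;
the infimum in `lowerEdge` is then attained. -/
lemma IsCutoff.isClosed_region {θ δ : ℝ} {Φ : ℝ≥0 → ℝ≥0 → ℝ} (hΦ : IsCutoff θ δ Φ) :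
    IsClosed (interactionRegion θ δ) :=
  hΦ.support_eq ▸ isClosed_tsupport _

lemma IsCutoff.mem_region {θ δ : ℝ} {Φ : ℝ≥0 → ℝ≥0 → ℝ} (hΦ : IsCutoff θ δ Φ) {k k' : ℝ≥0}
    (h : Φ k k' ≠ 0) : (k, k') ∈ interactionRegion θ δ :=
  hΦ.support_eq ▸ subset_tsupport (fun p : ℝ≥0 × ℝ≥0 => Φ p.1 p.2) h

lemma IsCutoff.diag_eq_one {θ δ : ℝ} {Φ : ℝ≥0 → ℝ≥0 → ℝ} (hΦ : IsCutoff θ δ Φ) (hθ : 0 < θ)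
    (k : ℝ≥0) : Φ k k = 1 := by
  obtain ⟨θ₁, ρ₁, h1, h2, h3, -, h⟩ := hΦ.eq_one
  exact h _ (diag_mem_region (hθ.trans h1) h2 h3.le k)

lemma IsCutoff.eventually_ne_zero {θ δ : ℝ} {Φ : ℝ≥0 → ℝ≥0 → ℝ} (hΦ : IsCutoff θ δ Φ)
    {k k' : ℝ≥0} (hk : 0 < k) (h : Φ k k' ≠ 0) : ∀ᶠ y in 𝓝 k, Φ y k' ≠ 0 := by
  have hc : ContinuousAt (fun p : ℝ≥0 × ℝ≥0 => Φ p.1 p.2) (k, k') :=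
    hΦ.continuousOn.continuousAt (isOpen_compl_singleton.mem_nhds (by simp [hk.ne']))
  have hc' : ContinuousAt (fun y => Φ y k') k :=
    ContinuousAt.comp (f := fun y : ℝ≥0 => (y, k')) hc (by fun_prop)
  exact hc'.eventually_ne h

section lowerEdge

variable {θ δ : ℝ}

lemma lowerEdge_le {x y : ℝ≥0} (h : (x, y) ∈ interactionRegion θ δ) : lowerEdge θ δ x ≤ y :=
  csInf_le (OrderBot.bddBelow _) h

lemma mk_self_mem_interactionRegion (hθ : 0 < θ) (hθ1 : θ < 1) (x : ℝ≥0) :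
    (x, x) ∈ interactionRegion θ δ :=
  diag_mem_region hθ hθ1 (rhoStar_nonneg hθ1) x

lemma lowerEdge_mono (hθ : 0 < θ) (hθ1 : θ < 1) (hδ : 0 < δ) : Monotone (lowerEdge θ δ) := by
  intro b x hbx
  refine le_csInf ⟨x, mk_self_mem_interactionRegion hθ hθ1 x⟩ fun y hy => ?_
  rcases le_total y b with h | h
  · exact lowerEdge_le (mk_mem_interactionRegion_of_le hθ hθ1 hδ h hbx hy)
  · exact (lowerEdge_le (mk_self_mem_interactionRegion hθ hθ1 b)).trans h

variable {Φ : ℝ≥0 → ℝ≥0 → ℝ}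

lemma IsCutoff.mk_lowerEdge_mem (hΦ : IsCutoff θ δ Φ) (hθ : 0 < θ) (hθ1 : θ < 1) (x : ℝ≥0) :
    (x, lowerEdge θ δ x) ∈ interactionRegion θ δ :=
  (hΦ.isClosed_region.preimage (by fun_prop : Continuous fun y : ℝ≥0 => (x, y))).csInf_mem
    ⟨x, mk_self_mem_interactionRegion hθ hθ1 x⟩ (OrderBot.bddBelow _)

lemma IsCutoff.lowerEdge_pos (hΦ : IsCutoff θ δ Φ) (hθ : 0 < θ) (hθ1 : θ < 1) {x : ℝ≥0}
    (hx : 0 < x) : 0 < lowerEdge θ δ x := by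
  refine pos_iff_ne_zero.2 fun h => mk_zero_notMem_interactionRegion (δ := δ) hθ hx ?_
  have := hΦ.mk_lowerEdge_mem hθ hθ1 x
  rwa [h] at this

/-- Strict because `Φ` stays nonzero at some smaller `y < k`. Hence the non-strict inequality
defining wide gaps already excludes interaction. -/
lemma IsCutoff.lowerEdge_lt (hΦ : IsCutoff θ δ Φ) {k k' : ℝ≥0} (hk : 0 < k) (h : Φ k k' ≠ 0) :
    lowerEdge θ δ k' < k := by
  have : (𝓝[<] k).NeBot := nhdsLT_neBot_of_exists_lt ⟨0, hk⟩
  obtain ⟨y, hy, hyk⟩ := (((hΦ.eventually_ne_zero hk h).filter_mono nhdsWithin_le_nhds).and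
    (self_mem_nhdsWithin (s := Iio k))).exists
  rw [hΦ.symm] at hy
  exact (lowerEdge_le (hΦ.mem_region hy)).trans_lt hyk

lemma IsCutoff.lowerEdge_lt_self (hΦ : IsCutoff θ δ Φ) (hθ : 0 < θ) {k : ℝ≥0} (hk : 0 < k) :
    lowerEdge θ δ k < k :=
  hΦ.lowerEdge_lt hk (by simp [hΦ.diag_eq_one hθ])

/-- Points which are separated by a wide gap do not interact. -/
lemma IsCutoff.rate_eq_zero_of_le_lowerEdge (hΦ : IsCutoff θ δ Φ) (hθ : 0 < θ) (hθ1 : θ < 1)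
    (hδ : 0 < δ) (β m : ℝ) {a b k k' : ℝ≥0} (hab : a ≤ lowerEdge θ δ b) (hk : k ≤ a)
    (hk' : b ≤ k') : rate β m Φ k k' = 0 := by
  rcases (zero_le (a := k)).eq_or_lt with h | h
  · rw [← h, rate_zero_left]
  · refine rate_eq_zero (not_not.1 fun hne => ?_)
    exact ((hΦ.lowerEdge_lt h hne).trans_le hk).not_ge
      (hab.trans (lowerEdge_mono hθ hθ1 hδ hk'))

/-- The rate is bounded away from the axis `k = 0`. -/
lemma IsCutoff.exists_abs_rate_le (hΦ : IsCutoff θ δ Φ) (hθ : 0 < θ) (hθ1 : θ < 1) (hδ : 0 < δ)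
    {β m : ℝ} (hβ : 0 < β) (hm : 0 < m) {ε : ℝ≥0} (hε : 0 < ε) :
    ∃ C, 0 ≤ C ∧ ∀ k k', ε ≤ k ∨ ε ≤ k' → |rate β m Φ k k'| ≤ C := by
  have hpos : 0 < lowerEdge θ δ ε := hΦ.lowerEdge_pos hθ hθ1 hε
  have hpos' : (0 : ℝ) < lowerEdge θ δ ε := hpos
  have hε' : (0 : ℝ) < ε := hε
  have key : ∀ k k', ε ≤ k → |rate β m Φ k k'| ≤
      4 * β * Real.sqrt β * Real.exp (β * m / 2) / (ε * lowerEdge θ δ ε) := by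
    intro k k' hk
    by_cases h : Φ k k' = 0
    · rw [rate_eq_zero h, abs_zero]
      positivity
    · refine (hΦ.abs_rate_le hβ hm k k').trans ?_
      have h1 : (ε : ℝ) ≤ k := hk
      -- An interaction partner of a point above `ε` cannot approach `0`, which controls `1 / (k
      -- k')`.
      have h2 : (lowerEdge θ δ ε : ℝ) ≤ k' :=
        (lowerEdge_mono hθ hθ1 hδ hk).trans (lowerEdge_le (hΦ.mem_region h))
      gcongr
  refine ⟨_, by positivity, fun k k' h => h.elim (key k k') fun h => ?_⟩
  rw [hΦ.rate_antisymm, abs_neg]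
  exact key k' k h

end lowerEdge

/-! ### Evolution of the integrals of test functions -/

section evolution

variable {β m θ δ η : ℝ} {Φ : ℝ≥0 → ℝ≥0 → ℝ} {v₀ : FiniteMeasure ℝ≥0}
  {v : C(ℝ≥0, FiniteMeasure ℝ≥0)} {φ : ℝ → ℝ}

lemma IsWeakSolution.absolutelyContinuousOnInterval (hv : IsWeakSolution β m Φ v₀ v)
    (hφ : IsTest φ) {s t : ℝ≥0} (hst : s ≤ t) :
    AbsolutelyContinuousOnInterval
      (fun r : ℝ => ∫ k : ℝ≥0, φ k ∂(v r.toNNReal : Measure ℝ≥0)) s t := by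
  obtain ⟨L, hL⟩ := hv.lipschitz φ hφ t
  refine LipschitzOnWith.absolutelyContinuousOnInterval (K := L * 1) ?_
  rw [uIcc_of_le (by exact_mod_cast hst)]
  exact hL.comp (Real.lipschitzWith_toNNReal.lipschitzOnWith) fun r hr =>
    Real.toNNReal_le_iff_le_coe.2 hr.2

lemma IsWeakSolution.ae_hasDerivAt (hv : IsWeakSolution β m Φ v₀ v)
    (hφ : IsTest φ) (s : ℝ≥0) :
    ∀ᵐ t : ℝ, (s : ℝ) < t →
      Integrable (fun p : ℝ≥0 × ℝ≥0 => rate β m Φ p.1 p.2 * (φ p.1 - φ p.2))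
        ((v t.toNNReal : Measure ℝ≥0).prod (v t.toNNReal : Measure ℝ≥0)) ∧
      HasDerivAt (fun s : ℝ => ∫ k : ℝ≥0, φ k ∂(v s.toNNReal : Measure ℝ≥0))
        (1 / 2 * ∫ p : ℝ≥0 × ℝ≥0, rate β m Φ p.1 p.2 * (φ p.1 - φ p.2)
          ∂((v t.toNNReal : Measure ℝ≥0).prod (v t.toNNReal : Measure ℝ≥0))) t := by
  filter_upwards [(ae_restrict_iff' measurableSet_Ioi).1 (hv.weak φ hφ)] with t ht hst
  exact ht (show (0 : ℝ) < t from s.2.trans_lt hst)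

/-- An upper bound for the interaction term gives an upper bound for the growth of `∫ φ dv(t)`. -/
lemma IsWeakSolution.integral_sub_le (hv : IsWeakSolution β m Φ v₀ v) (hφ : IsTest φ) {s t : ℝ≥0}
    (hst : s ≤ t) {c : ℝ}
    (h : ∀ r, s ≤ r → Integrable (fun p : ℝ≥0 × ℝ≥0 => rate β m Φ p.1 p.2 * (φ p.1 - φ p.2))
        ((v r : Measure ℝ≥0).prod (v r : Measure ℝ≥0)) →
      1 / 2 * ∫ p : ℝ≥0 × ℝ≥0, rate β m Φ p.1 p.2 * (φ p.1 - φ p.2)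
        ∂((v r : Measure ℝ≥0).prod (v r : Measure ℝ≥0)) ≤ c) :
    ∫ k : ℝ≥0, φ k ∂(v t : Measure ℝ≥0) - ∫ k : ℝ≥0, φ k ∂(v s : Measure ℝ≥0) ≤
      c * (t - s) := by
  have := sub_le_of_ae_deriv_le (c := c) (by exact_mod_cast hst)
    (hv.absolutelyContinuousOnInterval hφ hst) (by
      filter_upwards [hv.ae_hasDerivAt hφ s] with x hx hmem
      obtain ⟨h1, h2⟩ := hx hmem.1
      rw [h2.deriv]
      exact h _ (NNReal.le_toNNReal_of_coe_le hmem.1.le) h1)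
  simpa only [Real.toNNReal_coe] using this

lemma IsCutoff.rate_mul_sub_nonpos (hΦ : IsCutoff θ δ Φ) (hβ : 0 < β) (m : ℝ) (hφ : Monotone φ)
    (k k' : ℝ≥0) : rate β m Φ k k' * (φ k - φ k') ≤ 0 := by
  rcases le_total k k' with h | h
  · exact mul_nonpos_of_nonneg_of_nonpos (hΦ.rate_nonneg hβ m h) (sub_nonpos.2 (hφ h))
  · rw [hΦ.rate_antisymm]
    exact mul_nonpos_of_nonpos_of_nonneg (neg_nonpos.2 (hΦ.rate_nonneg hβ m h))
      (sub_nonneg.2 (hφ h))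

/-- The photons lose energy: the integrals of nondecreasing functions do not increase. -/
lemma IsWeakSolution.antitone_integral (hv : IsWeakSolution β m Φ v₀ v) (hΦ : IsCutoff θ δ Φ)
    (hβ : 0 < β) (hφ : IsTest φ) (hmono : Monotone φ) :
    Antitone fun t => ∫ k : ℝ≥0, φ k ∂(v t : Measure ℝ≥0) := by
  intro s t hst
  have := hv.integral_sub_le hφ hst (c := 0) fun r _ _ =>
    mul_nonpos_of_nonneg_of_nonpos (by norm_num)
      (integral_nonpos fun p => hΦ.rate_mul_sub_nonpos hβ m hmono p.1 p.2)
  dsimp only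
  linarith

lemma IsTest.neg (hφ : IsTest φ) : IsTest (fun x => -φ x) := by
  obtain ⟨h1, ⟨C, hC⟩, ⟨C', hC'⟩, h4⟩ := hφ
  have hd : ∀ x, derivWithin (fun x => -φ x) (Ici 0) x = -derivWithin φ (Ici 0) x := fun x =>
    derivWithin.fun_neg
  exact ⟨h1.neg, ⟨C, fun x hx => by rw [abs_neg]; exact hC x hx⟩,
    ⟨C', fun x hx => by rw [hd, abs_neg]; exact hC' x hx⟩, by rw [hd, h4, neg_zero]⟩

/-- If the interaction term of `φ` vanishes, then `∫ φ dv(t)` is conserved. -/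
lemma IsWeakSolution.integral_eq (hv : IsWeakSolution β m Φ v₀ v) (hφ : IsTest φ)
    (h : ∀ t, ∀ᵐ p : ℝ≥0 × ℝ≥0 ∂((v t : Measure ℝ≥0).prod (v t : Measure ℝ≥0)),
      rate β m Φ p.1 p.2 * (φ p.1 - φ p.2) = 0) (t : ℝ≥0) :
    ∫ k : ℝ≥0, φ k ∂(v t : Measure ℝ≥0) = ∫ k : ℝ≥0, φ k ∂(v₀ : Measure ℝ≥0) := by
  have h1 := hv.integral_sub_le hφ (zero_le (a := t)) (c := 0) fun r _ _ => by
    rw [integral_congr_ae (h r)]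
    simp
  have h2 := hv.integral_sub_le hφ.neg (zero_le (a := t)) (c := 0) fun r _ _ => by
    have : (fun p : ℝ≥0 × ℝ≥0 => rate β m Φ p.1 p.2 * (-φ p.1 - -φ p.2))
        =ᵐ[(v r : Measure ℝ≥0).prod (v r : Measure ℝ≥0)] fun _ => 0 := by
      filter_upwards [h r] with p hp
      linarith
    rw [integral_congr_ae this]
    simp
  rw [hv.initial] at h1 h2
  simp only [integral_neg] at h2
  linarith

/-- Gronwall's inequality: a nonnegative test function which does not see the singularity of the
rate keeps a zero integral. -/
lemma IsAdmissibleSolution.integral_eq_zero (hv : IsAdmissibleSolution β m η Φ v₀ v)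
    (hφ : IsTest φ) (hnn : ∀ x, 0 ≤ φ x) {C : ℝ}
    (hbound : ∀ k k' : ℝ≥0, |rate β m Φ k k' * (φ k - φ k')| ≤ C * (φ k + φ k'))
    (h0 : ∫ k : ℝ≥0, φ k ∂(v₀ : Measure ℝ≥0) = 0) (t : ℝ≥0) :
    ∫ k : ℝ≥0, φ k ∂(v t : Measure ℝ≥0) = 0 := by
  set K : ℝ := C * v₀.mass with hK
  have hmass : ∀ r, (v r : Measure ℝ≥0).real univ = v₀.mass := fun r => by
    rw [← hv.mass_eq r]
    rfl
  have hflux : ∀ r, 1 / 2 * ∫ p : ℝ≥0 × ℝ≥0, rate β m Φ p.1 p.2 * (φ p.1 - φ p.2)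
      ∂((v r : Measure ℝ≥0).prod (v r : Measure ℝ≥0)) ≤
      K * ∫ k : ℝ≥0, φ k ∂(v r : Measure ℝ≥0) := by
    intro r
    have hi1 : Integrable (fun p : ℝ≥0 × ℝ≥0 => φ p.1)
        ((v r : Measure ℝ≥0).prod (v r : Measure ℝ≥0)) := (hφ.integrable _).comp_fst _
    have hi2 : Integrable (fun p : ℝ≥0 × ℝ≥0 => φ p.2)
        ((v r : Measure ℝ≥0).prod (v r : Measure ℝ≥0)) := (hφ.integrable _).comp_snd _
    have h1 := norm_integral_le_of_norm_le (g := fun p : ℝ≥0 × ℝ≥0 => C * (φ p.1 + φ p.2))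
      (f := fun p : ℝ≥0 × ℝ≥0 => rate β m Φ p.1 p.2 * (φ p.1 - φ p.2))
      ((hi1.add hi2).const_mul C) (Eventually.of_forall fun p => hbound p.1 p.2)
    have h2 : ∫ p : ℝ≥0 × ℝ≥0, C * (φ p.1 + φ p.2)
        ∂((v r : Measure ℝ≥0).prod (v r : Measure ℝ≥0)) =
        2 * (K * ∫ k : ℝ≥0, φ k ∂(v r : Measure ℝ≥0)) := by
      rw [integral_const_mul, integral_add hi1 hi2,
        integral_fun_fst (fun k : ℝ≥0 => φ k), integral_fun_snd (fun k : ℝ≥0 => φ k), hmass,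
        smul_eq_mul]
      ring
    have h3 := (le_abs_self _).trans (h1.trans_eq h2)
    linarith
  -- Gronwall with the integrating factor `e^{-K x}`: its product with the integral has nonpositive
  -- derivative almost everywhere.
  have hexp : AbsolutelyContinuousOnInterval (fun x => Real.exp (-K * x)) ((0 : ℝ≥0) : ℝ) t :=
    ContDiffOn.absolutelyContinuousOnInterval (by fun_prop)
  have key := sub_le_of_ae_deriv_le (c := 0) t.coe_nonneg
    (hexp.fun_mul (hv.absolutelyContinuousOnInterval hφ (zero_le (a := t)))) (by
      filter_upwards [hv.ae_hasDerivAt hφ 0] with x hx hmem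
      have h2 := (hx hmem.1).2
      have he : HasDerivAt (fun x => Real.exp (-K * x)) (Real.exp (-K * x) * (-K * 1)) x :=
        ((hasDerivAt_id x).const_mul (-K)).exp
      rw [(he.fun_mul h2).deriv]
      have := hflux x.toNNReal
      nlinarith [Real.exp_pos (-K * x)])
  rw [Real.toNNReal_coe, Real.toNNReal_zero, hv.initial, h0, mul_zero, sub_zero,
    zero_mul] at key
  refine le_antisymm ?_ (integral_nonneg fun k => hnn k)
  exact nonpos_of_mul_nonpos_right key (Real.exp_pos _)

end evolution

/-! ### Propagation of the support -/

section support

variable {β m θ δ η : ℝ} {Φ : ℝ≥0 → ℝ≥0 → ℝ} {v₀ : FiniteMeasure ℝ≥0}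
  {v : C(ℝ≥0, FiniteMeasure ℝ≥0)}

/-- Since `a > 0`, either both bump values vanish or one variable is at least `a`, where the rate is
bounded; Gronwall applies. -/
lemma IsAdmissibleSolution.integral_bump_eq_zero (hv : IsAdmissibleSolution β m η Φ v₀ v)
    (hΦ : IsCutoff θ δ Φ) (hβ : 0 < β) (hm : 0 < m) (hθ : 0 < θ) (hθ1 : θ < 1) (hδ : 0 < δ)
    {a b : ℝ} (ha : 0 < a) (hab : a < b)
    (h : ∀ k ∈ (v₀ : Measure ℝ≥0).support, (k : ℝ) ∉ Ioo a b) (t : ℝ≥0) :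
    ∫ k : ℝ≥0, bump a b k ∂(v t : Measure ℝ≥0) = 0 := by
  have hnull : ∫ k : ℝ≥0, bump a b k ∂(v₀ : Measure ℝ≥0) = 0 := by
    refine Compton.integral_bump_eq_zero hab (measure_mono_null (fun k hk hkK => h k hkK hk)
      Measure.measure_compl_support)
  obtain ⟨C, hC0, hC⟩ := hΦ.exists_abs_rate_le hθ hθ1 hδ hβ hm
    (ε := a.toNNReal) (Real.toNNReal_pos.2 ha)
  refine hv.integral_eq_zero (C := C) (isTest_bump ha.le hab) (bump_nonneg a b) (fun k k' => ?_) hnull t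
  have h1 := bump_nonneg a b k
  have h2 := bump_nonneg a b k'
  rcases le_or_gt a k with hk | hk
  · rw [abs_mul]
    exact mul_le_mul (hC k k' (Or.inl (Real.toNNReal_le_iff_le_coe.2 hk)))
      (abs_sub_le_iff.2 ⟨by linarith, by linarith⟩) (abs_nonneg _) hC0
  rcases le_or_gt a k' with hk' | hk'
  · rw [abs_mul]
    exact mul_le_mul (hC k k' (Or.inr (Real.toNNReal_le_iff_le_coe.2 hk')))
      (abs_sub_le_iff.2 ⟨by linarith, by linarith⟩) (abs_nonneg _) hC0
  · rw [bump_eq_zero hab fun h => h.1.not_gt hk, bump_eq_zero hab fun h => h.1.not_gt hk']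
    simp

/-- The solution stays carried by the support of the initial datum. -/
lemma IsAdmissibleSolution.measure_compl_support (hv : IsAdmissibleSolution β m η Φ v₀ v)
    (hΦ : IsCutoff θ δ Φ) (hβ : 0 < β) (hm : 0 < m) (hθ : 0 < θ) (hθ1 : θ < 1) (hδ : 0 < δ)
    (t : ℝ≥0) : (v t : Measure ℝ≥0) (v₀ : Measure ℝ≥0).supportᶜ = 0 := by
  set K := (v₀ : Measure ℝ≥0).support with hK
  have hKc : IsClosed K := Measure.isClosed_support
  have hpos : ∀ r, (v r : Measure ℝ≥0) (Kᶜ ∩ Ioi 0) = 0 := fun r =>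
    measure_compl_eq_zero_of_bump hKc fun a b ha hab h =>
      hv.integral_bump_eq_zero hΦ hβ hm hθ hθ1 hδ ha hab h r
  by_cases h0 : (0 : ℝ≥0) ∈ K
  · refine measure_mono_null (fun k (hk : k ∉ K) => ?_) (hpos t)
    have hk0 : k ≠ 0 := fun h => hk (h ▸ h0)
    exact ⟨hk, pos_iff_ne_zero.2 hk0⟩
  -- It remains to exclude mass at `0`. All mass sits in `{0} ∪ [b, ∞)` and the rate vanishes on the
  -- axes, so `∫ step 0 b` is conserved; initially it is the full mass, leaving nothing below `b`.
  obtain ⟨b, hb, hsub⟩ := NNReal.nhds_zero_basis.mem_iff.1 (hKc.isOpen_compl.mem_nhds h0)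
  have hb' : (0 : ℝ) < b := hb
  have hae : ∀ r, ∀ᵐ k ∂(v r : Measure ℝ≥0), k = 0 ∨ b ≤ k := fun r => by
    filter_upwards [measure_eq_zero_iff_ae_notMem.1 (hpos r)] with k hk
    by_contra! h
    exact hk ⟨hsub h.2, pos_iff_ne_zero.2 h.1⟩
  have hcons := hv.integral_eq (isTest_step le_rfl hb') (fun r => by
    filter_upwards [Measure.quasiMeasurePreserving_fst.ae (hae r),
      Measure.quasiMeasurePreserving_snd.ae (hae r)] with p h1 h2
    rcases h1 with h1 | h1
    · rw [h1, rate_zero_left, zero_mul]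
    rcases h2 with h2 | h2
    · rw [h2, rate_zero_right, zero_mul]
    rw [step_eq_one hb' (NNReal.coe_le_coe.2 h1), step_eq_one hb' (NNReal.coe_le_coe.2 h2), sub_self, mul_zero]) t
  have h1 : ∫ k : ℝ≥0, step 0 b k ∂(v₀ : Measure ℝ≥0) = (v₀ : Measure ℝ≥0).real univ := by
    rw [integral_congr_ae (g := fun _ => (1 : ℝ)), integral_const, smul_eq_mul, mul_one]
    filter_upwards [Measure.support_mem_ae (μ := (v₀ : Measure ℝ≥0))] with k hk
    exact step_eq_one hb' (not_lt.1 fun h => hsub h hk)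
  have h2 : ∫ k : ℝ≥0, (1 - step 0 b k) ∂(v t : Measure ℝ≥0) = 0 := by
    rw [integral_sub (integrable_const _) ((isTest_step le_rfl hb').integrable _), hcons, h1,
      integral_const, smul_eq_mul, mul_one, sub_eq_zero]
    exact congrArg NNReal.toReal (hv.mass_eq t)
  rw [integral_eq_zero_iff_of_nonneg (fun k => sub_nonneg.2 (step_le_one _ _ _))
    ((integrable_const _).sub ((isTest_step le_rfl hb').integrable _))] at h2
  have h3 : (v t : Measure ℝ≥0) (Iio b) = 0 := by
    rw [measure_eq_zero_iff_ae_notMem]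
    filter_upwards [h2] with k hk hkb
    exact (sub_pos.2 (step_lt_one hb' (NNReal.coe_lt_coe.2 hkb))).ne' hk
  refine measure_mono_null (fun k hk => ?_) (measure_union_null (hpos t) h3)
  rcases (zero_le (a := k)).eq_or_lt with h | h
  · exact Or.inr (h ▸ hb)
  · exact Or.inl ⟨hk, h⟩

end support

/-! ### The long time limit -/

section limit

variable {β m θ δ η : ℝ} {Φ : ℝ≥0 → ℝ≥0 → ℝ} {v₀ μ : FiniteMeasure ℝ≥0}
  {v : C(ℝ≥0, FiniteMeasure ℝ≥0)}

lemma IsAdmissibleSolution.measureReal_Ioi_le (hv : IsAdmissibleSolution β m η Φ v₀ v)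
    (hΦ : IsCutoff θ δ Φ) (hβ : 0 < β) (t x : ℝ≥0) :
    (v t : Measure ℝ≥0).real (Ioi x) ≤ (v₀ : Measure ℝ≥0).real (Ioi x) := by
  refine measureReal_Ioi_le_of_integral_step_le (fun a b ha hab => ?_) x
  rw [← hv.initial]
  exact hv.antitone_integral hΦ hβ (isTest_step ha hab) (step_monotone hab) (zero_le (a := t))

/-- Since the energy only decreases, the solution converges narrowly as `t → ∞`. -/
lemma IsAdmissibleSolution.exists_tendsto (hv : IsAdmissibleSolution β m η Φ v₀ v)
    (hΦ : IsCutoff θ δ Φ) (hβ : 0 < β) :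
    ∃ μ : FiniteMeasure ℝ≥0, Tendsto v atTop (𝓝 μ) ∧ μ.mass = v₀.mass := by
  -- Tightness: these tails dominate those of every `v t`, so the trajectory lies in a compact set
  -- by Prokhorov's theorem.
  have hu : Tendsto (fun n : ℕ => v₀ (Ioi (n : ℝ≥0))) atTop (𝓝 0) := by
    have h1 : Tendsto (fun n : ℕ => (v₀ : Measure ℝ≥0) (Ioi (n : ℝ≥0))) atTop
        (𝓝 ((v₀ : Measure ℝ≥0) (⋂ n : ℕ, Ioi (n : ℝ≥0)))) :=
      tendsto_measure_iInter_atTop (fun n => measurableSet_Ioi.nullMeasurableSet)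
        (fun i j hij => Ioi_subset_Ioi (by exact_mod_cast hij)) ⟨0, measure_ne_top _ _⟩
    have h2 : ⋂ n : ℕ, Ioi (n : ℝ≥0) = ∅ := by
      refine eq_empty_of_forall_notMem fun x hx => ?_
      obtain ⟨n, hn⟩ := exists_nat_gt x
      exact (mem_iInter.1 hx n).not_gt hn
    rw [h2, measure_empty] at h1
    exact (ENNReal.tendsto_toNNReal ENNReal.zero_ne_top).comp h1
  have hcomp := isCompact_setOfPred_finiteMeasure_mass_eq_compl_isCompact_le (E := ℝ≥0) v₀.mass hu
    (K := fun n : ℕ => Iic (n : ℝ≥0))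
    (fun n => by rw [← Icc_bot]; exact isCompact_Icc) (Or.inl inferInstance)
  set F := {ν : FiniteMeasure ℝ≥0 | ν.mass = v₀.mass ∧
    ∀ n : ℕ, ν (Iic (n : ℝ≥0))ᶜ ≤ v₀ (Ioi (n : ℝ≥0))} with hF
  have hvF : ∀ t, v t ∈ F := fun t => ⟨hv.mass_eq t, fun n => by
    rw [compl_Iic]
    exact hv.measureReal_Ioi_le hΦ hβ t n⟩
  have hle : map v atTop ≤ 𝓟 F := tendsto_principal.2 (Eventually.of_forall hvF)
  obtain ⟨μ, hμF, hμ⟩ := hcomp.exists_clusterPt hle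
  -- Monotone bounded step integrals converge, so all cluster points share them.
  have hlim : ∀ a b : ℝ, 0 ≤ a → a < b → ∃ l : ℝ, ∀ ν : FiniteMeasure ℝ≥0,
      ClusterPt ν (map v atTop) → ∫ k : ℝ≥0, step a b k ∂(ν : Measure ℝ≥0) = l := by
    intro a b ha hab
    have hbdd : BddBelow (range fun t => ∫ k : ℝ≥0, step a b k ∂(v t : Measure ℝ≥0)) :=
      ⟨0, by rintro _ ⟨t, rfl⟩; exact integral_nonneg fun k => step_nonneg _ _ _⟩
    have hanti := hv.antitone_integral hΦ hβ (isTest_step ha hab) (step_monotone hab)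
    refine ⟨⨅ t, ∫ k : ℝ≥0, step a b k ∂(v t : Measure ℝ≥0), fun ν hν => ?_⟩
    have h1 : MapClusterPt ν atTop v := hν
    have h2 := h1.continuousAt_comp
      (FiniteMeasure.continuous_integral_boundedContinuousFunction
        (isTest_step ha hab).toBCF).continuousAt
    have h3 := tendsto_atTop_ciInf hanti hbdd
    exact eq_of_nhds_neBot (NeBot.mono h2 (inf_le_inf_left _ h3))
  refine ⟨μ, hcomp.le_nhds_of_unique_clusterPt (le_principal_iff.1 hle) fun ν hν hcl => ?_, hμF.1⟩
  refine eq_of_integral_step_eq (hν.1.trans hμF.1.symm) fun a b ha hab => ?_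
  obtain ⟨l, hl⟩ := hlim a b ha hab
  rw [hl ν hcl, hl μ hμ]

/-- Portmanteau on the closed support of `v₀`, which carries the full mass at every time. -/
lemma IsAdmissibleSolution.limit_measure_compl_support (hv : IsAdmissibleSolution β m η Φ v₀ v)
    (hΦ : IsCutoff θ δ Φ) (hβ : 0 < β) (hm : 0 < m) (hθ : 0 < θ) (hθ1 : θ < 1) (hδ : 0 < δ)
    (hlim : Tendsto v atTop (𝓝 μ)) (hmass : μ.mass = v₀.mass) :
    (μ : Measure ℝ≥0) (v₀ : Measure ℝ≥0).supportᶜ = 0 := by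
  have hK : IsClosed (v₀ : Measure ℝ≥0).support := Measure.isClosed_support
  have h := FiniteMeasure.limsup_measure_closed_le_of_tendsto hlim hK
  have h1 : ∀ t, (v t : Measure ℝ≥0) (v₀ : Measure ℝ≥0).support = v₀.mass := fun t => by
    rw [← hv.mass_eq t, FiniteMeasure.ennreal_mass]
    have := measure_add_measure_compl (μ := (v t : Measure ℝ≥0)) hK.measurableSet
    rwa [hv.measure_compl_support hΦ hβ hm hθ hθ1 hδ t, add_zero] at this
  simp only [h1, limsup_const] at h
  rw [measure_compl hK.measurableSet (measure_ne_top _ _), ← FiniteMeasure.ennreal_mass, hmass]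
  exact tsub_eq_zero_of_le h

/-- No two points of the support of the limit interact. -/
lemma IsAdmissibleSolution.cutoff_eq_zero_of_lt (hv : IsAdmissibleSolution β m η Φ v₀ v)
    (hΦ : IsCutoff θ δ Φ) (hβ : 0 < β) (hm : 0 < m) (hθ : 0 < θ)
    (hlim : Tendsto v atTop (𝓝 μ)) {k k' : ℝ≥0} (hk : k ∈ (μ : Measure ℝ≥0).support)
    (hk' : k' ∈ (μ : Measure ℝ≥0).support) (hlt : k < k') : Φ k k' = 0 := by
  by_contra hne
  have hk0 : 0 < k := by
    refine pos_iff_ne_zero.2 fun h => ?_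
    rw [hΦ.symm] at hne
    exact mk_zero_notMem_interactionRegion hθ (zero_le.trans_lt hlt) (h ▸ hΦ.mem_region hne)
  obtain ⟨c, hc, hev⟩ := hΦ.exists_le_rate hβ hm hk0 hlt hne
  -- The step rises between `d` and `e`, strictly inside `(k, k')`, so it is constant near each of
  -- the two points.
  obtain ⟨d, hkd, hdk'⟩ := exists_between hlt
  obtain ⟨e, hde, hek'⟩ := exists_between hdk'
  rw [nhds_prod_eq] at hev
  obtain ⟨U, hU, V, hV, hUV⟩ := eventually_prod_iff.1 hev
  obtain ⟨a, b, hab, hsub⟩ := (mem_nhds_iff_exists_Ioo_subset' ⟨0, hk0⟩ ⟨k', hlt⟩).1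
    (inter_mem hU (Iio_mem_nhds hkd))
  obtain ⟨a', b', hab', hsub'⟩ := (mem_nhds_iff_exists_Ioo_subset' ⟨k, hlt⟩ ⟨k' + 1, by simp⟩).1
    (inter_mem hV (Ioi_mem_nhds hek'))
  have hlt1 : (a : ℝ) < b := hab.1.trans hab.2
  have hlt2 : (a' : ℝ) < b' := hab'.1.trans hab'.2
  have hde' : (d : ℝ) < e := hde
  have hφ := isTest_step d.coe_nonneg hde'
  have hψ := isTest_bump a.coe_nonneg hlt1
  have hψ' := isTest_bump a'.coe_nonneg hlt2
  -- Near `(k, k')` the step difference is `-1` and the rate at least `c`; elsewhere the sign of the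
  -- dissipation suffices.
  have hpt : ∀ p : ℝ≥0 × ℝ≥0, rate β m Φ p.1 p.2 * (step d e p.1 - step d e p.2) ≤
      -c * (bump a b p.1 * bump a' b' p.2) := by
    intro p
    by_cases h1 : (p.1 : ℝ) ∈ Ioo (a : ℝ) b
    · by_cases h2 : (p.2 : ℝ) ∈ Ioo (a' : ℝ) b'
      · obtain ⟨hp1, hp1'⟩ := hsub (show p.1 ∈ Ioo a b by simpa using h1)
        obtain ⟨hp2, hp2'⟩ := hsub' (show p.2 ∈ Ioo a' b' by simpa using h2)
        have hr := hUV hp1 hp2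
        have hle := mul_le_one₀ (bump_le_one a b p.1) (bump_nonneg a' b' p.2)
          (bump_le_one a' b' p.2)
        rw [step_eq_zero hde' (NNReal.coe_le_coe.2 (le_of_lt hp1')),
          step_eq_one hde' (NNReal.coe_le_coe.2 (le_of_lt hp2'))]
        nlinarith
      · rw [bump_eq_zero hlt2 h2]
        simpa using hΦ.rate_mul_sub_nonpos hβ m (step_monotone hde') p.1 p.2
    · rw [bump_eq_zero hlt1 h1]
      simpa using hΦ.rate_mul_sub_nonpos hβ m (step_monotone hde') p.1 p.2
  have hpos1 := integral_bump_pos (ν := (μ : Measure ℝ≥0)) a.coe_nonneg hk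
    (show (k : ℝ) ∈ Ioo (a : ℝ) b by simpa using hab)
  have hpos2 := integral_bump_pos (ν := (μ : Measure ℝ≥0)) a'.coe_nonneg hk'
    (show (k' : ℝ) ∈ Ioo (a' : ℝ) b' by simpa using hab')
  have hprod := (hψ.tendsto_integral hlim).mul (hψ'.tendsto_integral hlim)
  set P := (∫ k : ℝ≥0, bump a b k ∂(μ : Measure ℝ≥0)) *
    ∫ k : ℝ≥0, bump a' b' k ∂(μ : Measure ℝ≥0) with hP
  have hPpos : 0 < P := mul_pos hpos1 hpos2
  obtain ⟨T, hT⟩ := eventually_atTop.1 (hprod.eventually (lt_mem_nhds (half_lt_self hPpos)))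
  -- The `4` combines the `1 / 2` of the weak form with the lower bound `P / 2` after time `T`.
  have hdecay : ∀ t, T ≤ t → ∫ k : ℝ≥0, step d e k ∂(v t : Measure ℝ≥0) -
      ∫ k : ℝ≥0, step d e k ∂(v T : Measure ℝ≥0) ≤ -(c * P / 4) * (t - T) := by
    intro t ht
    refine hv.integral_sub_le hφ ht fun r hr hint => ?_
    have h1 := integral_mono hint (((hψ.integrable (v r : Measure ℝ≥0)).mul_prod
      (hψ'.integrable (v r : Measure ℝ≥0))).const_mul (-c)) hpt
    rw [integral_const_mul, integral_prod_mul (fun k : ℝ≥0 => bump a b k)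
      (fun k : ℝ≥0 => bump a' b' k)] at h1
    have h2 := hT r hr
    nlinarith
  set g := ∫ k : ℝ≥0, step d e k ∂(v T : Measure ℝ≥0) with hg
  have hg0 : 0 ≤ g := integral_nonneg fun k => step_nonneg _ _ _
  have hs : 0 ≤ (g + 1) / (c * P / 4) := by positivity
  -- After this waiting time the step integral would be at most `-1`.
  have h1 := hdecay (T + ((g + 1) / (c * P / 4)).toNNReal) le_self_add
  have h2 : 0 ≤ ∫ k : ℝ≥0, step d e k
      ∂(v (T + ((g + 1) / (c * P / 4)).toNNReal) : Measure ℝ≥0) :=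
    integral_nonneg fun k => step_nonneg _ _ _
  rw [NNReal.coe_add, Real.coe_toNNReal _ hs, add_sub_cancel_left, neg_mul,
    mul_div_cancel₀ _ (by positivity : c * P / 4 ≠ 0)] at h1
  linarith

lemma IsAdmissibleSolution.cutoff_eq_zero (hv : IsAdmissibleSolution β m η Φ v₀ v)
    (hΦ : IsCutoff θ δ Φ) (hβ : 0 < β) (hm : 0 < m) (hθ : 0 < θ)
    (hlim : Tendsto v atTop (𝓝 μ)) {k k' : ℝ≥0} (hk : k ∈ (μ : Measure ℝ≥0).support)
    (hk' : k' ∈ (μ : Measure ℝ≥0).support) (hne : k ≠ k') : Φ k k' = 0 := by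
  rcases hne.lt_or_gt with h | h
  · exact hv.cutoff_eq_zero_of_lt hΦ hβ hm hθ hlim hk hk' h
  · rw [hΦ.symm]
    exact hv.cutoff_eq_zero_of_lt hΦ hβ hm hθ hlim hk' hk h

end limit

/-! ### Measures whose support does not interact -/

section atomic

variable {θ δ : ℝ} {Φ : ℝ≥0 → ℝ≥0 → ℝ} {μ : Measure ℝ≥0}

/-- Positive support points are isolated, since `Φ k k = 1` and `Φ` is continuous there. The origin
is excluded because continuity may fail at it. -/
lemma IsCutoff.eventually_eq_of_mem_support (hΦ : IsCutoff θ δ Φ) (hθ : 0 < θ)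
    (h : ∀ k ∈ μ.support, ∀ k' ∈ μ.support, k ≠ k' → Φ k k' = 0) {k : ℝ≥0} (hk0 : 0 < k)
    (hk : k ∈ μ.support) : ∀ᶠ y in 𝓝 k, y ∈ μ.support → y = k := by
  filter_upwards [hΦ.eventually_ne_zero hk0 (k' := k) (by simp [hΦ.diag_eq_one hθ])] with y hy hys
  exact not_not.1 fun hne => hy (h y hys k hk hne)

lemma IsCutoff.measure_singleton_pos (hΦ : IsCutoff θ δ Φ) (hθ : 0 < θ)
    (h : ∀ k ∈ μ.support, ∀ k' ∈ μ.support, k ≠ k' → Φ k k' = 0) {k : ℝ≥0} (hk0 : 0 < k)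
    (hk : k ∈ μ.support) : 0 < μ {k} := by
  have h1 := (Measure.mem_support_iff_forall k).1 hk _
    (hΦ.eventually_eq_of_mem_support hθ h hk0 hk)
  have h2 : {y | y ∈ μ.support → y = k} ⊆ {k} ∪ μ.supportᶜ := fun y hy => by
    by_cases hys : y ∈ μ.support
    · exact Or.inl (hy hys)
    · exact Or.inr hys
  have h3 := h1.trans_le ((measure_mono h2).trans (measure_union_le _ _))
  rwa [Measure.measure_compl_support, add_zero] at h3

/-- The positive part is a discrete, separable subspace; the origin, where points might accumulate,
adds at most one element. -/
lemma IsCutoff.countable_support (hΦ : IsCutoff θ δ Φ) (hθ : 0 < θ)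
    (h : ∀ k ∈ μ.support, ∀ k' ∈ μ.support, k ≠ k' → Φ k k' = 0) : μ.support.Countable := by
  have h1 : (μ.support ∩ Ioi 0).Countable := by
    have : DiscreteTopology ↥(μ.support ∩ Ioi 0) := by
      refine discreteTopology_subtype_iff.2 fun x hx => ?_
      rw [inf_principal_eq_bot]
      refine mem_nhdsWithin_iff_exists_mem_nhds_inter.2
        ⟨_, hΦ.eventually_eq_of_mem_support hθ h hx.2 hx.1, ?_⟩
      rintro y ⟨hy, hne⟩ hys
      exact hne (hy hys.1)
    exact countable_coe_iff.1 (TopologicalSpace.separableSpace_iff_countable.1 inferInstance)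
  refine (h1.union (countable_singleton 0)).mono fun k hk => ?_
  rcases (zero_le (a := k)).eq_or_lt with h0 | h0
  · exact Or.inr h0.symm
  · exact Or.inl ⟨hk, h0⟩

lemma eq_sum_smul_dirac_of_countable {S : Set ℝ≥0} (hS : S.Countable) (h : μ Sᶜ = 0) :
    μ = Measure.sum fun k : S => μ {(k : ℝ≥0)} • Measure.dirac (k : ℝ≥0) := by
  have := hS.to_subtype
  have h1 : μ.restrict S = μ := Measure.restrict_eq_self_of_ae_mem (mem_ae_iff.2 h)
  have h2 : ⋃ k : S, {(k : ℝ≥0)} = S := iUnion_of_singleton_coe S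
  have h3 := Measure.restrict_iUnion (μ := μ) (s := fun k : S => {(k : ℝ≥0)})
    (fun k l hkl => by simpa [Function.onFun, Subtype.ext_iff] using hkl)
    (fun k => measurableSet_singleton _)
  rw [h2, h1] at h3
  simpa only [Measure.restrict_singleton] using h3

/-- A measure with countable support is carried by its atoms. -/
lemma measure_compl_atoms_eq_zero (h : μ.support.Countable) : μ {k : ℝ≥0 | μ {k} ≠ 0}ᶜ = 0 := by
  have h1 : μ (μ.support \ {k : ℝ≥0 | μ {k} ≠ 0}) = 0 := by
    rw [← biUnion_of_singleton (μ.support \ {k : ℝ≥0 | μ {k} ≠ 0}),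
      measure_biUnion_null_iff (h.mono sdiff_subset)]
    exact fun k hk => not_not.1 hk.2
  refine measure_mono_null (fun k hk => ?_) (measure_union_null h1
    (Measure.measure_compl_support (μ := μ)))
  by_cases hks : k ∈ μ.support
  · exact Or.inl ⟨hks, hk⟩
  · exact Or.inr hks

lemma mem_support_of_measure_singleton_ne_zero {k : ℝ≥0} (h : μ {k} ≠ 0) : k ∈ μ.support := by
  by_contra hks
  exact h (measure_mono_null (singleton_subset_iff.2 hks) Measure.measure_compl_support)

end atomic

/-! ### Wide gaps and blocks -/

section components

variable {W : Set ℝ≥0} {x : ℝ≥0}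

lemma ordConnected_connectedComponentIn : (connectedComponentIn W x).OrdConnected :=
  isPreconnected_connectedComponentIn.ordConnected

/-- Were `[y, x]` disjoint from `W`, it would belong to the component of `x`. Order-connectedness
then places the point found below the whole component. -/
lemma exists_mem_Icc_of_lt_component (hx : x ∈ Wᶜ) {y : ℝ≥0}
    (hy : ∀ c ∈ connectedComponentIn Wᶜ x, y < c) :
    ∃ p ∈ W, y ≤ p ∧ ∀ c ∈ connectedComponentIn Wᶜ x, p < c := by
  have hxC := mem_connectedComponentIn hx
  have hyx := hy x hxC
  obtain ⟨p, hp, hpW⟩ : ∃ p ∈ Icc y x, p ∈ W := by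
    by_contra! h
    have := isPreconnected_Icc.subset_connectedComponentIn (right_mem_Icc.2 hyx.le) (F := Wᶜ) h
    exact (hy y (this (left_mem_Icc.2 hyx.le))).false
  refine ⟨p, hpW, hp.1, fun c hc => not_le.1 fun hcp => ?_⟩
  exact connectedComponentIn_subset _ _
    (ordConnected_connectedComponentIn.out hc hxC ⟨hcp, hp.2⟩) hpW

lemma exists_mem_Icc_of_component_lt (hx : x ∈ Wᶜ) {y : ℝ≥0}
    (hy : ∀ c ∈ connectedComponentIn Wᶜ x, c < y) :
    ∃ p ∈ W, p ≤ y ∧ ∀ c ∈ connectedComponentIn Wᶜ x, c < p := by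
  have hxC := mem_connectedComponentIn hx
  have hyx := hy x hxC
  obtain ⟨p, hp, hpW⟩ : ∃ p ∈ Icc x y, p ∈ W := by
    by_contra! h
    have := isPreconnected_Icc.subset_connectedComponentIn (left_mem_Icc.2 hyx.le) (F := Wᶜ) h
    exact (hy y (this (right_mem_Icc.2 hyx.le))).false
  refine ⟨p, hpW, hp.2, fun c hc => not_le.1 fun hcp => ?_⟩
  exact connectedComponentIn_subset _ _
    (ordConnected_connectedComponentIn.out hxC hc ⟨hp.1, hcp⟩) hpW

lemma lt_component_of_notMem {y k : ℝ≥0} (hk : k ∈ connectedComponentIn Wᶜ x)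
    (hy : y ∉ connectedComponentIn Wᶜ x) (hyk : y ≤ k) :
    ∀ c ∈ connectedComponentIn Wᶜ x, y < c := fun _ hc => not_le.1 fun hcy =>
  hy (ordConnected_connectedComponentIn.out hc hk ⟨hcy, hyk⟩)

lemma component_lt_of_notMem {y k : ℝ≥0} (hk : k ∈ connectedComponentIn Wᶜ x)
    (hy : y ∉ connectedComponentIn Wᶜ x) (hyk : k ≤ y) :
    ∀ c ∈ connectedComponentIn Wᶜ x, c < y := fun _ hc => not_le.1 fun hcy =>
  hy (ordConnected_connectedComponentIn.out hk hc ⟨hyk, hcy⟩)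

lemma measurableSet_lt_component :
    MeasurableSet {y | ∀ c ∈ connectedComponentIn Wᶜ x, y < c} :=
  (⟨fun _ _ _ hb _ hz c hc => hz.2.trans_lt (hb c hc)⟩ :
    OrdConnected {y | ∀ c ∈ connectedComponentIn Wᶜ x, y < c}).measurableSet

lemma measurableSet_component_lt :
    MeasurableSet {y | ∀ c ∈ connectedComponentIn Wᶜ x, c < y} :=
  (⟨fun _ ha _ _ _ hz c hc => (ha c hc).trans_le hz.1⟩ :
    OrdConnected {y | ∀ c ∈ connectedComponentIn Wᶜ x, c < y}).measurableSet

variable {μ ν : Measure ℝ≥0} [IsFiniteMeasure μ]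

/-- By inner regularity it suffices to treat compact sets; the greatest element of such a set is
separated from the component by some `p ∈ W`. -/
lemma measure_lt_component_le (hx : x ∈ Wᶜ) (h : ∀ p ∈ W, μ (Iic p) = ν (Iic p)) :
    μ {y | ∀ c ∈ connectedComponentIn Wᶜ x, y < c} ≤
      ν {y | ∀ c ∈ connectedComponentIn Wᶜ x, y < c} := by
  rw [measurableSet_lt_component.measure_eq_iSup_isCompact_of_ne_top (measure_ne_top _ _)]
  refine iSup₂_le fun F hF => iSup_le fun hFc => ?_
  rcases F.eq_empty_or_nonempty with rfl | hne
  · simp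
  obtain ⟨y, hyF, hy⟩ := hFc.exists_isGreatest hne
  obtain ⟨p, hpW, hyp, hp⟩ := exists_mem_Icc_of_lt_component hx (hF hyF)
  calc μ F ≤ μ (Iic p) := measure_mono fun z hz => (hy hz).trans hyp
    _ = ν (Iic p) := h p hpW
    _ ≤ _ := measure_mono fun z (hz : z ≤ p) c hc => hz.trans_lt (hp c hc)

lemma measure_component_lt_le (hx : x ∈ Wᶜ) (h : ∀ p ∈ W, μ (Ici p) = ν (Ici p)) :
    μ {y | ∀ c ∈ connectedComponentIn Wᶜ x, c < y} ≤
      ν {y | ∀ c ∈ connectedComponentIn Wᶜ x, c < y} := by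
  rw [measurableSet_component_lt.measure_eq_iSup_isCompact_of_ne_top (measure_ne_top _ _)]
  refine iSup₂_le fun F hF => iSup_le fun hFc => ?_
  rcases F.eq_empty_or_nonempty with rfl | hne
  · simp
  obtain ⟨y, hyF, hy⟩ := hFc.exists_isLeast hne
  obtain ⟨p, hpW, hyp, hp⟩ := exists_mem_Icc_of_component_lt hx (hF hyF)
  calc μ F ≤ μ (Ici p) := measure_mono fun z hz => hyp.trans (hy hz)
    _ = ν (Ici p) := h p hpW
    _ ≤ _ := measure_mono fun z (hz : p ≤ z) c hc => (hp c hc).trans_le hz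

variable [IsFiniteMeasure ν]

lemma measure_lt_component_eq (hx : x ∈ Wᶜ) (h : ∀ p ∈ W, μ (Iic p) = ν (Iic p)) :
    μ {y | ∀ c ∈ connectedComponentIn Wᶜ x, y < c} =
      ν {y | ∀ c ∈ connectedComponentIn Wᶜ x, y < c} :=
  le_antisymm (measure_lt_component_le hx h)
    (measure_lt_component_le hx fun p hp => (h p hp).symm)

/-- Two measures which agree on the half lines with endpoint in `W` agree on the components of the
complement of `W`. -/
lemma measure_component_eq (hx : x ∈ Wᶜ) (h : ∀ p ∈ W, μ (Iic p) = ν (Iic p))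
    (h' : ∀ p ∈ W, μ (Ici p) = ν (Ici p)) (huniv : μ univ = ν univ) :
    μ (connectedComponentIn Wᶜ x) = ν (connectedComponentIn Wᶜ x) := by
  have hxC := mem_connectedComponentIn hx
  set L := {y | ∀ c ∈ connectedComponentIn Wᶜ x, y < c} with hL
  set U := {y | ∀ c ∈ connectedComponentIn Wᶜ x, c < y} with hU
  have hLU : Disjoint L U := disjoint_left.2 fun y h1 h2 => ((h1 x hxC).trans (h2 x hxC)).false
  have hC : connectedComponentIn Wᶜ x = (L ∪ U)ᶜ := by
    ext y
    refine ⟨fun hy hyLU => hyLU.elim (fun h => (h y hy).false) fun h => (h y hy).false,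
      fun hy => ?_⟩
    by_contra hyC
    rcases le_total y x with hle | hle
    · exact hy (Or.inl (lt_component_of_notMem hxC hyC hle))
    · exact hy (Or.inr (component_lt_of_notMem hxC hyC hle))
  have h1 := measure_lt_component_eq hx h
  have h2 := le_antisymm (measure_component_lt_le hx h')
    (measure_component_lt_le hx fun p hp => (h' p hp).symm)
  have hm : MeasurableSet (L ∪ U) := measurableSet_lt_component.union measurableSet_component_lt
  rw [hC, measure_compl hm (measure_ne_top _ _), measure_compl hm (measure_ne_top _ _), huniv,
    measure_union hLU measurableSet_component_lt, measure_union hLU measurableSet_component_lt,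
    h1, h2]

end components

/-! ### Mass balance across wide gaps and at block minima -/

section gaps

variable {β m θ δ η : ℝ} {Φ : ℝ≥0 → ℝ≥0 → ℝ} {K : Set ℝ≥0}

lemma wideGaps_subset_compl : wideGaps θ δ K ⊆ Kᶜ := by
  rintro p ⟨I, ⟨⟨x, -, rfl⟩, -⟩, hp⟩
  exact connectedComponentIn_subset _ _ hp

/-- Points of `K` on the two sides of a wide gap are separated by its endpoints. -/
lemma exists_le_lowerEdge_of_mem_wideGaps {p k k' : ℝ≥0} (hp : p ∈ wideGaps θ δ K) (hk : k ∈ K)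
    (hk' : k' ∈ K) (hkp : k ≤ p) (hpk' : p ≤ k') :
    ∃ a b, k ≤ a ∧ b ≤ k' ∧ a ≤ lowerEdge θ δ b := by
  obtain ⟨I, ⟨⟨x, -, rfl⟩, -, hI⟩, hpI⟩ := hp
  have hsub := connectedComponentIn_subset Kᶜ x
  refine ⟨_, _, le_csInf ⟨p, hpI⟩ fun i hi => not_lt.1 fun hik => ?_,
    csSup_le ⟨p, hpI⟩ fun i hi => not_lt.1 fun hik => ?_, hI⟩
  · exact hsub (ordConnected_connectedComponentIn.out hi hpI ⟨hik.le, hkp⟩) hk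
  · exact hsub (ordConnected_connectedComponentIn.out hpI hi ⟨hpk', hik.le⟩) hk'

lemma IsCutoff.rate_eq_zero_of_mem_wideGaps (hΦ : IsCutoff θ δ Φ) (hθ : 0 < θ) (hθ1 : θ < 1)
    (hδ : 0 < δ) (β m : ℝ) {p k k' : ℝ≥0} (hp : p ∈ wideGaps θ δ K) (hk : k ∈ K)
    (hk' : k' ∈ K) (hkp : k ≤ p) (hpk' : p ≤ k') : rate β m Φ k k' = 0 := by
  obtain ⟨a, b, h1, h2, h3⟩ := exists_le_lowerEdge_of_mem_wideGaps hp hk hk' hkp hpk'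
  exact hΦ.rate_eq_zero_of_le_lowerEdge hθ hθ1 hδ β m h3 h1 h2

/-- Just below the minimum of a block there are no points of `K`. -/
lemma le_lowerEdge_of_lt_isLeast (hθ : 0 < θ) (hθ1 : θ < 1) (hδ : 0 < δ) {x k y : ℝ≥0}
    (hx : x ∈ (wideGaps θ δ K)ᶜ)
    (hk : IsLeast (connectedComponentIn (wideGaps θ δ K)ᶜ x ∩ K) k) (hy : y ∈ K) (hyk : y < k) :
    y ≤ lowerEdge θ δ k := by
  have hyC : y ∉ connectedComponentIn (wideGaps θ δ K)ᶜ x := fun h => (hk.2 ⟨h, hy⟩).not_gt hyk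
  obtain ⟨p, hpW, hyp, hp⟩ :=
    exists_mem_Icc_of_lt_component hx (lt_component_of_notMem hk.1.1 hyC hyk.le)
  obtain ⟨a, b, h1, h2, h3⟩ :=
    exists_le_lowerEdge_of_mem_wideGaps hpW hy hk.1.2 hyp (hp k hk.1.1).le
  exact h1.trans (h3.trans (lowerEdge_mono hθ hθ1 hδ h2))

lemma integral_step_eq_measureReal_Ioi {ν : Measure ℝ≥0} (hν : ν Kᶜ = 0) {p q : ℝ≥0}
    (hpq : p < q) (h : ∀ k ∈ K, k ≤ p ∨ q ≤ k) :
    ∫ k : ℝ≥0, step p q k ∂ν = ν.real (Ioi p) := by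
  have hpq' : (p : ℝ) < q := hpq
  rw [← integral_indicator_one measurableSet_Ioi]
  refine integral_congr_ae ?_
  filter_upwards [measure_eq_zero_iff_ae_notMem.1 hν] with k hk
  rcases h k (not_not.1 hk) with h | h
  · rw [indicator_of_notMem (by simpa using h), step_eq_zero hpq' (NNReal.coe_le_coe.2 h)]
  · rw [indicator_of_mem (show k ∈ Ioi p from hpq.trans_le h), step_eq_one hpq' (NNReal.coe_le_coe.2 h)]
    rfl

variable {v₀ μ : FiniteMeasure ℝ≥0} {v : C(ℝ≥0, FiniteMeasure ℝ≥0)}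

/-- No mass crosses a wide gap. -/
lemma IsAdmissibleSolution.measureReal_Ioi_eq (hv : IsAdmissibleSolution β m η Φ v₀ v)
    (hΦ : IsCutoff θ δ Φ) (hβ : 0 < β) (hm : 0 < m) (hθ : 0 < θ) (hθ1 : θ < 1) (hδ : 0 < δ)
    (hlim : Tendsto v atTop (𝓝 μ)) (hmass : μ.mass = v₀.mass) {p : ℝ≥0}
    (hp : p ∈ wideGaps θ δ (v₀ : Measure ℝ≥0).support) :
    (μ : Measure ℝ≥0).real (Ioi p) = (v₀ : Measure ℝ≥0).real (Ioi p) := by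
  set K := (v₀ : Measure ℝ≥0).support with hK
  have hKc : IsClosed K := Measure.isClosed_support
  have hnull := hv.measure_compl_support hΦ hβ hm hθ hθ1 hδ
  -- The step rises within `[p, q]`, which misses `K`, so on `K` it is the indicator of `Ioi p`.
  -- Pairs on one side cancel in the step difference; pairs across the gap have zero rate.
  obtain ⟨q, hpq, hq⟩ := (mem_nhdsGE_iff_exists_Icc_subset (a := p)).1
    (mem_nhdsWithin_of_mem_nhds (hKc.isOpen_compl.mem_nhds (wideGaps_subset_compl hp)))
  have hpq' : (p : ℝ) < q := hpq
  have hsep : ∀ k ∈ K, k ≤ p ∨ q ≤ k := fun k hk => by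
    by_contra! h
    exact hq ⟨h.1.le, h.2.le⟩ hk
  have hφ := isTest_step p.coe_nonneg hpq'
  have hcons := hv.integral_eq hφ fun t => by
    have hae := measure_eq_zero_iff_ae_notMem.1 (hnull t)
    filter_upwards [Measure.quasiMeasurePreserving_fst.ae hae,
      Measure.quasiMeasurePreserving_snd.ae hae] with r h1 h2
    have h1 := not_not.1 h1
    have h2 := not_not.1 h2
    rcases hsep _ h1 with h3 | h3 <;> rcases hsep _ h2 with h4 | h4
    · rw [step_eq_zero hpq' (NNReal.coe_le_coe.2 h3), step_eq_zero hpq' (NNReal.coe_le_coe.2 h4),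
        sub_self, mul_zero]
    · rw [hΦ.rate_eq_zero_of_mem_wideGaps hθ hθ1 hδ β m hp h1 h2 h3 (hpq.le.trans h4), zero_mul]
    · rw [hΦ.rate_antisymm,
        hΦ.rate_eq_zero_of_mem_wideGaps hθ hθ1 hδ β m hp h2 h1 h4 (hpq.le.trans h3), neg_zero,
        zero_mul]
    · rw [step_eq_one hpq' (NNReal.coe_le_coe.2 h3), step_eq_one hpq' (NNReal.coe_le_coe.2 h4),
        sub_self, mul_zero]
  have h1 := hφ.tendsto_integral hlim
  simp only [hcons] at h1
  rw [← integral_step_eq_measureReal_Ioi (hv.limit_measure_compl_support hΦ hβ hm hθ hθ1 hδ hlim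
    hmass) hpq hsep, ← integral_step_eq_measureReal_Ioi Measure.measure_compl_support hpq hsep]
  exact tendsto_nhds_unique h1 tendsto_const_nhds

/-- Mass only moves down, and the decrease of step integrals passes to the limit. -/
lemma IsAdmissibleSolution.limit_measure_Iic_ge (hv : IsAdmissibleSolution β m η Φ v₀ v)
    (hΦ : IsCutoff θ δ Φ) (hβ : 0 < β) (hlim : Tendsto v atTop (𝓝 μ)) (hmass : μ.mass = v₀.mass)
    (x : ℝ≥0) : (v₀ : Measure ℝ≥0) (Iic x) ≤ (μ : Measure ℝ≥0) (Iic x) := by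
  have h1 : (μ : Measure ℝ≥0).real (Ioi x) ≤ (v₀ : Measure ℝ≥0).real (Ioi x) := by
    refine measureReal_Ioi_le_of_integral_step_le (fun a b ha hab => ?_) x
    have hanti := hv.antitone_integral hΦ hβ (isTest_step ha hab) (step_monotone hab)
    rw [← hv.initial]
    exact le_of_tendsto' ((isTest_step ha hab).tendsto_integral hlim)
      fun t => hanti (zero_le (a := t))
  have h2 : (μ : Measure ℝ≥0) (Ioi x) ≤ (v₀ : Measure ℝ≥0) (Ioi x) :=
    (ENNReal.toReal_le_toReal (measure_ne_top _ _) (measure_ne_top _ _)).1 h1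
  rw [← compl_Ioi, measure_compl measurableSet_Ioi (measure_ne_top _ _),
    measure_compl measurableSet_Ioi (measure_ne_top _ _), ← FiniteMeasure.ennreal_mass,
    ← FiniteMeasure.ennreal_mass, hmass]
  exact tsub_le_tsub_left h2 _

lemma IsAdmissibleSolution.measure_Iic_eq (hv : IsAdmissibleSolution β m η Φ v₀ v)
    (hΦ : IsCutoff θ δ Φ) (hβ : 0 < β) (hm : 0 < m) (hθ : 0 < θ) (hθ1 : θ < 1) (hδ : 0 < δ)
    (hlim : Tendsto v atTop (𝓝 μ)) (hmass : μ.mass = v₀.mass) {p : ℝ≥0}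
    (hp : p ∈ wideGaps θ δ (v₀ : Measure ℝ≥0).support) :
    (μ : Measure ℝ≥0) (Iic p) = (v₀ : Measure ℝ≥0) (Iic p) := by
  have h1 := (measureReal_eq_measureReal_iff (measure_ne_top _ _) (measure_ne_top _ _)).1
    (hv.measureReal_Ioi_eq hΦ hβ hm hθ hθ1 hδ hlim hmass hp)
  rw [← compl_Ioi, measure_compl measurableSet_Ioi (measure_ne_top _ _),
    measure_compl measurableSet_Ioi (measure_ne_top _ _), ← FiniteMeasure.ennreal_mass,
    ← FiniteMeasure.ennreal_mass, hmass, h1]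

lemma IsAdmissibleSolution.measure_Ici_eq (hv : IsAdmissibleSolution β m η Φ v₀ v)
    (hΦ : IsCutoff θ δ Φ) (hβ : 0 < β) (hm : 0 < m) (hθ : 0 < θ) (hθ1 : θ < 1) (hδ : 0 < δ)
    (hlim : Tendsto v atTop (𝓝 μ)) (hmass : μ.mass = v₀.mass) {p : ℝ≥0}
    (hp : p ∈ wideGaps θ δ (v₀ : Measure ℝ≥0).support) :
    (μ : Measure ℝ≥0) (Ici p) = (v₀ : Measure ℝ≥0) (Ici p) := by
  have h1 := (measureReal_eq_measureReal_iff (measure_ne_top _ _) (measure_ne_top _ _)).1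
    (hv.measureReal_Ioi_eq hΦ hβ hm hθ hθ1 hδ hlim hmass hp)
  -- A gap point is null for both measures, so `Ioi p` may be replaced by `Ici p`.
  have hsub : {p} ⊆ (v₀ : Measure ℝ≥0).supportᶜ := singleton_subset_iff.2 (wideGaps_subset_compl hp)
  have h2 := measure_mono_null hsub
    (hv.limit_measure_compl_support hΦ hβ hm hθ hθ1 hδ hlim hmass)
  have h3 := measure_mono_null hsub Measure.measure_compl_support
  have hdisj : Disjoint (Ioi p) {p} := by simp
  rw [← Ioi_union_left, measure_union hdisj (measurableSet_singleton p),
    measure_union hdisj (measurableSet_singleton p), h1, h2, h3]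

/-- The mass of each block is conserved in the limit. -/
lemma IsAdmissibleSolution.limit_measure_block (hv : IsAdmissibleSolution β m η Φ v₀ v)
    (hΦ : IsCutoff θ δ Φ) (hβ : 0 < β) (hm : 0 < m) (hθ : 0 < θ) (hθ1 : θ < 1) (hδ : 0 < δ)
    (hlim : Tendsto v atTop (𝓝 μ)) (hmass : μ.mass = v₀.mass) {A : Set ℝ≥0}
    (hA : A ∈ blocks θ δ v₀) : (μ : Measure ℝ≥0) A = (v₀ : Measure ℝ≥0) A := by
  obtain ⟨x, hx, rfl⟩ := hA
  rw [measure_inter_conull (hv.limit_measure_compl_support hΦ hβ hm hθ hθ1 hδ hlim hmass),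
    measure_inter_conull Measure.measure_compl_support]
  refine measure_component_eq hx
    (fun p hp => hv.measure_Iic_eq hΦ hβ hm hθ hθ1 hδ hlim hmass hp)
    (fun p hp => hv.measure_Ici_eq hΦ hβ hm hθ hθ1 hδ hlim hmass hp) ?_
  rw [← FiniteMeasure.ennreal_mass, ← FiniteMeasure.ennreal_mass, hmass]

/-- The positive minimum of a block belongs to the support of the limit. -/
lemma IsAdmissibleSolution.isLeast_block_mem_support (hv : IsAdmissibleSolution β m η Φ v₀ v)
    (hΦ : IsCutoff θ δ Φ) (hβ : 0 < β) (hm : 0 < m) (hθ : 0 < θ) (hθ1 : θ < 1) (hδ : 0 < δ)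
    (hlim : Tendsto v atTop (𝓝 μ)) (hmass : μ.mass = v₀.mass) {A : Set ℝ≥0}
    (hA : A ∈ blocks θ δ v₀) {k : ℝ≥0} (hk : IsLeast A k) (hk0 : 0 < k) :
    k ∈ (μ : Measure ℝ≥0).support := by
  obtain ⟨x, hx, rfl⟩ := hA
  set K := (v₀ : Measure ℝ≥0).support with hK
  have hμK := hv.limit_measure_compl_support hΦ hβ hm hθ hθ1 hδ hlim hmass
  -- Up to null sets, the mass below `k` is the mass below the whole component, which is unchanged
  -- in the limit.
  have hIio : (μ : Measure ℝ≥0) (Iio k) = (v₀ : Measure ℝ≥0) (Iio k) := by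
    have hae : ∀ ν : Measure ℝ≥0, ν Kᶜ = 0 → ν (Iio k) =
        ν {y | ∀ c ∈ connectedComponentIn (wideGaps θ δ K)ᶜ x, y < c} := by
      intro ν hν
      refine measure_congr (eventuallyEq_set.2 ?_)
      filter_upwards [measure_eq_zero_iff_ae_notMem.1 hν] with y hy
      refine ⟨fun hyk => lt_component_of_notMem hk.1.1 (fun h => ?_) (le_of_lt hyk),
        fun h => h k hk.1.1⟩
      exact (hk.2 ⟨h, not_not.1 hy⟩).not_gt hyk
    rw [hae _ hμK, hae _ Measure.measure_compl_support]
    exact measure_lt_component_eq hx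
      fun p hp => hv.measure_Iic_eq hΦ hβ hm hθ hθ1 hδ hlim hmass hp
  have hpos : ∀ z, k < z → 0 < (μ : Measure ℝ≥0) (Icc k z) := by
    intro z hz
    have hg := hΦ.lowerEdge_lt_self hθ hk0
    have h1 : 0 < (v₀ : Measure ℝ≥0) (Icc k z) := by
      -- No point of `K` lies strictly between `lowerEdge θ δ k` and `k`, so this neighbourhood is
      -- charged only from `k` upwards.
      have h2 := (Measure.mem_support_iff_forall k).1 hk.1.2 _ (Ioo_mem_nhds hg hz)
      refine h2.trans_le ((measure_mono (t := Icc k z ∪ Kᶜ) fun y hy => ?_).trans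
        ((measure_union_le _ _).trans_eq ?_))
      · rcases le_or_gt k y with h | h
        · exact Or.inl ⟨h, hy.2.le⟩
        · exact Or.inr fun hyK => (le_lowerEdge_of_lt_isLeast hθ hθ1 hδ hx hk hyK h).not_gt hy.1
      · rw [hK, Measure.measure_compl_support, add_zero]
    have h3 := hv.limit_measure_Iic_ge hΦ hβ hlim hmass z
    have hdisj : Disjoint (Iio k) (Icc k z) :=
      disjoint_left.2 fun y hy hy' => (not_lt.2 hy'.1) hy
    rw [← Iio_union_Icc_eq_Iic hz.le, measure_union hdisj measurableSet_Icc,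
      measure_union hdisj measurableSet_Icc, hIio,
      ENNReal.add_le_add_iff_left (measure_ne_top _ _)] at h3
    exact h1.trans_le h3
  refine (Measure.mem_support_iff_forall k).2 fun U hU => ?_
  obtain ⟨z, hkz, hz⟩ := (mem_nhdsGE_iff_exists_Icc_subset (a := k)).1
    (mem_nhdsWithin_of_mem_nhds hU)
  exact (hpos z hkz).trans_le (measure_mono hz)

end gaps

/-- For a constant limit, one threshold `T` serves all later times at once. -/
lemma tendsto_shift {v : C(ℝ≥0, FiniteMeasure ℝ≥0)} {μ : FiniteMeasure ℝ≥0}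
    (h : Tendsto v atTop (𝓝 μ)) :
    Tendsto (fun s : ℝ≥0 => shift s v) atTop (𝓝 (ContinuousMap.const ℝ≥0 μ)) := by
  refine ContinuousMap.tendsto_nhds_compactOpen.2 fun C hC U hU hmaps => ?_
  rcases C.eq_empty_or_nonempty with rfl | ⟨x, hx⟩
  · exact Eventually.of_forall fun s => mapsTo_empty _ _
  obtain ⟨T, hT⟩ := eventually_atTop.1 (h.eventually (hU.mem_nhds (hmaps hx)))
  filter_upwards [eventually_ge_atTop T] with s hs t _
  exact hT _ (hs.trans le_add_self)

end Compton

/-! ### The limit as a sum of atoms -/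

theorem theorem1p5 (β m θ δ η : ℝ) (hβ : 0 < β) (hm : 0 < m)
    (hθ : 0 < θ) (hθ1 : θ < 1) (hδ : 0 < δ) (hη : (1 - θ) / 2 ≤ η)
    (Φ : ℝ≥0 → ℝ≥0 → ℝ) (hΦ : Compton.IsCutoff θ δ Φ)
    (v₀ : FiniteMeasure ℝ≥0) (hv₀ : Compton.expMoment η v₀ < ∞)
    (v : C(ℝ≥0, FiniteMeasure ℝ≥0)) (hv : Compton.IsAdmissibleSolution β m η Φ v₀ v) :
    ∃ (μ : FiniteMeasure ℝ≥0) (S : Set ℝ≥0) (M : ℝ≥0 → ℝ≥0),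
      S.Countable ∧ (∀ k ∈ S, 0 < M k) ∧
      (μ : Measure ℝ≥0) = Measure.sum (fun k : S => (M k : ℝ≥0∞) • Measure.dirac (k : ℝ≥0)) ∧
      Tendsto (fun s : ℝ≥0 => Compton.shift s v) atTop (𝓝 (ContinuousMap.const ℝ≥0 μ)) ∧
      S ⊆ (v₀ : Measure ℝ≥0).support ∧
      (∀ k ∈ S, ∀ k' ∈ S, k ≠ k' → Φ k k' = 0) ∧
      (∀ A ∈ Compton.blocks θ δ v₀,
        ∑' k : {k : ℝ≥0 // k ∈ S ∧ k ∈ A}, (M k : ℝ≥0∞) = (v₀ : Measure ℝ≥0) A) ∧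
      (∀ A ∈ Compton.blocks θ δ v₀, ∀ k, IsLeast A k → 0 < k → k ∈ S) := by
  obtain ⟨μ, hlim, hmass⟩ := hv.exists_tendsto hΦ hβ
  have hzero : ∀ k ∈ (μ : Measure ℝ≥0).support, ∀ k' ∈ (μ : Measure ℝ≥0).support, k ≠ k' →
      Φ k k' = 0 := fun k hk k' hk' hne => hv.cutoff_eq_zero hΦ hβ hm hθ hlim hk hk' hne
  have hcount := hΦ.countable_support hθ hzero
  have hμK := hv.limit_measure_compl_support hΦ hβ hm hθ hθ1 hδ hlim hmass
  -- Atoms rather than the support: the origin might be a support point without mass.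
  set S : Set ℝ≥0 := {k | (μ : Measure ℝ≥0) {k} ≠ 0} with hS
  have hSsupp : S ⊆ (μ : Measure ℝ≥0).support := fun k hk =>
    Compton.mem_support_of_measure_singleton_ne_zero hk
  have hSc : S.Countable := hcount.mono hSsupp
  have hSnull : (μ : Measure ℝ≥0) Sᶜ = 0 := Compton.measure_compl_atoms_eq_zero hcount
  have hM : ∀ k : ℝ≥0, ((μ {k} : ℝ≥0) : ℝ≥0∞) = (μ : Measure ℝ≥0) {k} := fun k =>
    FiniteMeasure.ennreal_coeFn_eq_coeFn_toMeasure μ {k}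
  refine ⟨μ, S, fun k => μ {k}, hSc, fun k hk => ?_, ?_, Compton.tendsto_shift hlim, fun k hk => ?_,
    fun k hk k' hk' => hzero k (hSsupp hk) k' (hSsupp hk'), fun A hA => ?_, fun A hA k hk hk0 => ?_⟩
  · rw [← ENNReal.coe_pos, hM]
    exact pos_iff_ne_zero.2 hk
  · simp only [hM]
    exact Compton.eq_sum_smul_dirac_of_countable hSc hSnull
  · by_contra hkK
    exact hk (measure_mono_null (singleton_subset_iff.2 hkK) hμK)
  · simp only [hM]
    have : Countable {k : ℝ≥0 // k ∈ S ∧ k ∈ A} := (hSc.mono inter_subset_left).to_subtype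
    rw [← hv.limit_measure_block hΦ hβ hm hθ hθ1 hδ hlim hmass hA, ← measure_iUnion
      (fun k l hkl => by simpa [Function.onFun, Subtype.ext_iff] using hkl)
      (fun k => measurableSet_singleton _),
      show ⋃ k : {k : ℝ≥0 // k ∈ S ∧ k ∈ A}, {(k : ℝ≥0)} = S ∩ A from
        iUnion_of_singleton_coe (S ∩ A)]
    refine measure_congr (eventuallyEq_set.2 ?_)
    filter_upwards [measure_eq_zero_iff_ae_notMem.1 hSnull] with k hk
    exact ⟨fun h => h.2, fun h => ⟨not_not.1 hk, h⟩⟩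
  · exact (hΦ.measure_singleton_pos hθ hzero hk0
      (hv.isLeast_block_mem_support hΦ hβ hm hθ hθ1 hδ hlim hmass hA hk hk0)).ne'
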